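/- Let $(n_k)_{k\ge1}$ be a (strictly) increasing sequence of positive integers such that for every $p\ge2$ it satisfies condition $\mathbf A_p$: there is a constant $C_p\ge1$ such that for every integer $b\ne0$ and all nonzero integers $a_1,\dots,a_p$, the equation $a_1n_{k_1}+\dots+a_pn_{k_p}=b$ has at most $C_p$ nondegenerate solutions $(k_1,\dots,k_p)$, where a solution is called nondegenerate if no nonempty subsum of the left-hand side equals $0$. Let $f:\mathbb R\to\mathbb R$ be a measurable function with $f(x+1)=f(x)$ for all $x$, $\int_0^1 f(x)\,dx=0$, and finite total variation on $[0,1]$. Let $\sigma:\mathbb N\to\mathbb N$ be a permutation of the positive integers, and assume that the (finite) limit $$\gamma=\lim_{N\to\infty}\frac1N\int_0^1\Big(\sum_{k=1}^N f(n_{\sigma(k)}x)\Big)^2dx$$ exists. Then $$N^{-1/2}\sum_{k=1}^N f(n_{\sigma(k)}x)\ \longrightarrow_d\ \mathcal N(0,\gamma)\qquad(N\to\infty),$$ where the left-hand side is regarded as a random variable on $(0,1)$ with Lebesgue measure, and $\mathcal N(0,0)$ is the point mass at $0$. -/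

import Mathlib

open MeasureTheory ProbabilityTheory Filter Topology

namespace LacunaryPerm

/-- The tuple of indices `k = (k₁, …, k_p)` is a nondegenerate solution of
`a₁ n_{k₁} + … + a_p n_{k_p} = b`: the equation holds, and no (nonempty) subsum of its left hand
side equals `0`. The indices are not required to be distinct. -/
def IsNondegenerateSolution (n : ℕ → ℕ) {p : ℕ} (a : Fin p → ℤ) (b : ℤ) (k : Fin p → ℕ) : Prop :=
  ∑ i, a i * (n (k i) : ℤ) = b ∧
    ∀ s : Finset (Fin p), s.Nonempty → ∑ i ∈ s, a i * (n (k i) : ℤ) ≠ 0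

/-- Condition `A_p`: there is a constant `C_p ≥ 1` such that, for every integer `b ≠ 0` and all
nonzero integers `a₁, …, a_p`, the number of nondegenerate solutions of
`a₁ n_{k₁} + … + a_p n_{k_p} = b` is at most `C_p`. -/
def ConditionA (n : ℕ → ℕ) (p : ℕ) : Prop :=
  ∃ C : ℕ, 1 ≤ C ∧ ∀ b : ℤ, b ≠ 0 → ∀ a : Fin p → ℤ, (∀ i, a i ≠ 0) →
    {k : Fin p → ℕ | IsNondegenerateSolution n a b k}.encard ≤ C

/-- Lebesgue measure on the interval `(0, 1)`. -/
noncomputable def lebesgueUnit : Measure ℝ := volume.restrict (Set.Ioo 0 1)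

instance : IsProbabilityMeasure lebesgueUnit :=
  ⟨by simp [lebesgueUnit]⟩

/-- The permuted sum `∑ f(n_{σ(k)} x)` over the first `N` indices `k`. Sequences are indexed by
`ℕ`, so these are `k = 0, …, N - 1`. -/
noncomputable def permSum (f : ℝ → ℝ) (n : ℕ → ℕ) (σ : Equiv.Perm ℕ) (N : ℕ) (x : ℝ) : ℝ :=
  ∑ k ∈ Finset.range N, f ((n (σ k) : ℝ) * x)

end LacunaryPerm

/-! The proof is a method of moments that is uniform over finite index sets `F`. The order of
summation therefore plays no role, and `σ` enters only through the limiting variance `γ`.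

Replace `f` by a Fourier partial sum with frequencies in a fixed finite set. The sum over `k ∈ F`
becomes a trigonometric sum over letters `z = (j, k)` with values `j * n k`, and its `q`-th moment
is a weighted count of `q`-tuples of letters with vanishing total. Fix one position `i₀` and take a
minimal vanishing block containing it. Once the letter at `i₀` is chosen, the rest of the block is a
nondegenerate representation of a nonzero integer, so the conditions `A_p` leave boundedly many
choices. A block of any size thus costs one factor `card Z`, whereas square-root normalization pays
for two letters. Only pairs matter to leading order, and the moments satisfy the Gaussian recursion
`M (q + 2) ≈ (q + 1) * M 2 * M q` (`exists_moment_recursion_bound`, `exists_moment_approx`). Taylor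
expansion turns this into a comparison of the characteristic function with that of the normal law
having the actual variance of the sum, so no convergence of the variance is needed at this stage
(`exists_charFun_approx`).

Passing back to `f` needs a mean-square bound `ε * F.card` for the tail of the Fourier series,
uniform in `F` (`exists_integral_sub_sum_fpartial_le`). The coefficients are `O(1 / |j|)` by bounded
variation, so the tail is controlled by the sum of `1 / |j j'|` over coincidences `j * n k = j' * n
k'`. Condition `A_2` makes these coincidences sparse (`exists_card_ratio_bound`,
`exists_gcd_sum_bound`). Fixing the truncation level first and letting `N → ∞` afterwards gives
convergence of characteristic functions, hence convergence in distribution. -/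

namespace LacunaryPerm

set_option linter.unusedSectionVars false

/-! ### Counting tuples of letters with prescribed sum -/

section Counting

variable {Z : Type} (v : Z → ℤ) (ι : Type) [Fintype ι]

/-- Tuples of letters whose values add up to `b`. -/
def reps (b : ℤ) : Set (ι → Z) := {z | ∑ i, v (z i) = b}

/-- Tuples of letters whose values add up to `b` and have no vanishing nonempty subsum. -/
def nondegReps (b : ℤ) : Set (ι → Z) :=
  {z | ∑ i, v (z i) = b ∧ ∀ s : Finset ι, s.Nonempty → ∑ i ∈ s, v (z i) ≠ 0}

/-- Tuples of letters with vanishing total sum and no other vanishing nonempty subsum. -/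
def primReps : Set (ι → Z) :=
  {z | ∑ i, v (z i) = 0 ∧ ∀ s : Finset ι, s.Nonempty → ∑ i ∈ s, v (z i) = 0 → s = Finset.univ}

/-- The values are nonzero, and nondegenerate representations of nonzero integers by `p` letters
number at most `C p`. -/
structure NondegBound (C : ℕ → ℕ) : Prop where
  ne_zero : ∀ z, v z ≠ 0
  ncard_le : ∀ (κ : Type) [Fintype κ] (b : ℤ), b ≠ 0 →
    (nondegReps v κ b).ncard ≤ C (Fintype.card κ)

variable [Fintype Z] {v ι}

lemma ncard_le_mul_of_restrict (p : ι → Prop) (S : Set (ι → Z)) (T : Set ({i // p i} → Z)) (m : ℕ)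
    (h1 : ∀ z ∈ S, (fun i : {i // p i} => z i) ∈ T)
    (h2 : ∀ y ∈ T, {x : {i // ¬ p i} → Z | ∃ z ∈ S, (fun i : {i // p i} => z i) = y ∧
      (fun i : {i // ¬ p i} => z i) = x}.ncard ≤ m) :
    S.ncard ≤ T.ncard * m := by
  classical
  have hS := S.toFinite
  have hT := T.toFinite
  rw [Set.ncard_eq_toFinset_card S hS, Set.ncard_eq_toFinset_card T hT, mul_comm]
  refine (Finset.card_le_mul_card_image (f := fun z : ι → Z => fun i : {i // p i} => z i)
    hS.toFinset m ?_).trans ?_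
  · intro y hy
    obtain ⟨z, hz, rfl⟩ := Finset.mem_image.1 hy
    refine le_trans ?_ (h2 _ (h1 z (hS.mem_toFinset.1 hz)))
    rw [← Set.ncard_coe_finset]
    refine Set.ncard_le_ncard_of_injOn (fun z => fun i : {i // ¬ p i} => z i) ?_ ?_ (Set.toFinite _)
    · intro x hx
      simp only [Finset.coe_filter, Set.Finite.mem_toFinset, Set.mem_ofPred_eq] at hx
      exact ⟨x, hx.1, hx.2, rfl⟩
    · intro x hx x' hx' hxx
      simp only [Finset.coe_filter, Set.Finite.mem_toFinset, Set.mem_ofPred_eq] at hx hx'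
      have h := hx.2.trans hx'.2.symm
      funext i
      by_cases hi : p i
      · exact congrFun h ⟨i, hi⟩
      · exact congrFun hxx ⟨i, hi⟩
  · gcongr
    intro y hy
    obtain ⟨z, hz, rfl⟩ := Finset.mem_image.1 hy
    exact hT.mem_toFinset.2 (h1 z (hS.mem_toFinset.1 hz))

lemma sum_subtype_add_sum_subtype_not {p : ι → Prop} {_ : Fintype {i // p i}}
    {_ : Fintype {i // ¬ p i}} (g : ι → ℤ) :
    (∑ i : {i // p i}, g i) + ∑ i : {i // ¬ p i}, g i = ∑ i, g i := by
  classical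
  rw [← Fintype.sum_subtype_add_sum_subtype p g]
  congr!

/-- Once the letter at `i₀` is chosen, the others represent the nonzero integer `-v (z i₀)`, and by
primitivity without vanishing subsums. -/
lemma ncard_primReps_le {C : ℕ → ℕ} (hC : NondegBound v C) (i₀ : ι) :
    (primReps v ι).ncard ≤ Fintype.card Z * C (Fintype.card ι - 1) := by
  classical
  have key := ncard_le_mul_of_restrict (fun i => i = i₀) (primReps v ι) Set.univ
    (C (Fintype.card ι - 1)) (fun _ _ => Set.mem_univ _) ?_
  · refine key.trans (le_of_eq ?_)
    rw [Set.ncard_univ, Nat.card_eq_fintype_card, Fintype.card_fun]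
    simp
  · intro y _
    have h0 : -v (y ⟨i₀, rfl⟩) ≠ 0 := neg_ne_zero.2 (hC.ne_zero _)
    have hcard : Fintype.card {i // ¬ i = i₀} = Fintype.card ι - 1 := by
      rw [Fintype.card_subtype_compl]; simp
    rw [← hcard]
    refine le_trans (Set.ncard_le_ncard ?_ (Set.toFinite _)) (hC.ncard_le {i // ¬ i = i₀} _ h0)
    rintro x ⟨z, ⟨hz, hz'⟩, rfl, rfl⟩
    refine ⟨?_, fun s hs h => ?_⟩
    · have : ∑ i : {i // i = i₀}, v (z i) + ∑ i : {i // ¬ i = i₀}, v (z i) = ∑ i, v (z i) :=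
        sum_subtype_add_sum_subtype_not (fun i => v (z i))
      rw [hz] at this
      rw [Fintype.sum_subsingleton _ (⟨i₀, rfl⟩ : {i // i = i₀})] at this
      simp only
      linarith
    · have := hz' (s.map (Function.Embedding.subtype _)) (by simpa using hs)
        (by simpa [Finset.sum_map] using h)
      have h2 : i₀ ∈ s.map (Function.Embedding.subtype _) := this ▸ Finset.mem_univ i₀
      simp at h2

/-- Take `I` of least cardinality among the vanishing index sets containing `i₀`. A nonempty
vanishing `t ⊆ I` containing `i₀` equals `I` by minimality; one avoiding `i₀` would make `I \ t` a
smaller candidate. -/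
lemma exists_primReps_restrict [DecidableEq ι] {z : ι → Z} (hz : ∑ i, v (z i) = 0) (i₀ : ι) :
    ∃ I : Finset ι, i₀ ∈ I ∧ (fun i : {i // i ∈ I} => z i) ∈ primReps v {i // i ∈ I} ∧
      (fun i : {i // i ∉ I} => z i) ∈ reps v {i // i ∉ I} 0 := by
  classical
  obtain ⟨I, hI, hmin⟩ := Finset.exists_min_image
    (Finset.univ.filter fun I : Finset ι => i₀ ∈ I ∧ ∑ i ∈ I, v (z i) = 0) Finset.card
    ⟨Finset.univ, by simpa using hz⟩
  simp only [Finset.mem_filter, Finset.mem_univ, true_and] at hI hmin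
  have hsum : ∑ i : {i // i ∈ I}, v (z i) = 0 := by
    rw [← hI.2, Finset.sum_subtype I (fun _ => Iff.rfl)]
  refine ⟨I, hI.1, ⟨hsum, ?_⟩, ?_⟩
  · intro s hs h0
    set t := s.map (Function.Embedding.subtype _) with ht
    have htI : t ⊆ I := by
      intro i hi
      obtain ⟨j, _, rfl⟩ := Finset.mem_map.1 hi
      exact j.2
    have ht0 : ∑ i ∈ t, v (z i) = 0 := by simpa [ht, Finset.sum_map] using h0
    have htI' : t = I := by
      by_cases h : i₀ ∈ t
      · exact Finset.eq_of_subset_of_card_le htI (hmin t ⟨h, ht0⟩)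
      · exfalso
        have h1 := hmin (I \ t) ⟨Finset.mem_sdiff.2 ⟨hI.1, h⟩, by
          have := Finset.sum_sdiff (f := fun i => v (z i)) htI
          rw [ht0, hI.2] at this; simpa using this⟩
        have h2 : (I \ t).card < I.card := by
          apply Finset.card_lt_card
          refine Finset.sdiff_ssubset htI ?_
          simpa [ht] using hs
        omega
    ext ⟨i, hi⟩
    rw [← htI'] at hi
    obtain ⟨j, hj, hji⟩ := Finset.mem_map.1 hi
    simp only [Finset.mem_univ, iff_true]
    convert hj
    exact hji.symm
  · have : ∑ i : {i // i ∈ I}, v (z i) + ∑ i : {i // i ∉ I}, v (z i) = ∑ i, v (z i) :=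
      sum_subtype_add_sum_subtype_not (fun i => v (z i))
    rw [hz, hsum, zero_add] at this
    exact this

lemma ncard_prim_reps_le [DecidableEq ι] {C : ℕ → ℕ} (hC : NondegBound v C) {I : Finset ι} (hI : I.Nonempty) :
    {z : ι → Z | (fun i : {i // i ∈ I} => z i) ∈ primReps v {i // i ∈ I} ∧
      (fun i : {i // i ∉ I} => z i) ∈ reps v {i // i ∉ I} 0}.ncard ≤
      Fintype.card Z * C (I.card - 1) * (reps v {i // i ∉ I} 0).ncard := by
  classical
  obtain ⟨i₀, hi₀⟩ := hI
  have h := ncard_primReps_le (ι := {i // i ∈ I}) hC ⟨i₀, hi₀⟩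
  rw [Fintype.card_coe] at h
  refine le_trans (ncard_le_mul_of_restrict (fun i => i ∈ I) _ _ _ (fun z hz => hz.1)
    fun y _ => ?_) (Nat.mul_le_mul_right _ h)
  refine Set.ncard_le_ncard ?_ (Set.toFinite _)
  rintro x ⟨z, hz, rfl, rfl⟩
  exact hz.2

lemma sqrt_card_pow_le [Nonempty Z] {m k : ℕ} (h : m ≤ k) :
    √(Fintype.card Z : ℝ) ^ m ≤ √(Fintype.card Z : ℝ) ^ k := by
  refine pow_le_pow_right₀ ?_ h
  rw [Real.one_le_sqrt]
  exact_mod_cast Fintype.card_pos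

lemma ncard_le_sum_of_exists {α β : Type} [Finite α] (S : Set α) (s : Finset β) (R : β → Set α)
    (h : ∀ a ∈ S, ∃ b ∈ s, a ∈ R b) : S.ncard ≤ ∑ b ∈ s, (R b).ncard := by
  classical
  have : S ⊆ ⋃ b ∈ s, R b := fun a ha => by simpa using h a ha
  refine (Set.ncard_le_ncard this (Set.toFinite _)).trans ?_
  exact Finset.set_ncard_biUnion_le s R

lemma card_subtype_notMem [DecidableEq ι] (I : Finset ι) :
    Fintype.card {i // i ∉ I} = Fintype.card ι - I.card := by
  classical
  rw [Fintype.card_subtype_compl, Fintype.card_coe]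

/-- Vanishing tuples in which the vanishing minimal block of `i₀` has at least `r` members. -/
lemma ncard_large_block_le [DecidableEq ι] {C : ℕ → ℕ} [Nonempty Z] (hC : NondegBound v C) (i₀ : ι) {r : ℕ}
    {K : ℕ → ℝ} (hK : ∀ q < Fintype.card ι, 0 ≤ K q ∧
      ∀ (κ : Type) [Fintype κ], Fintype.card κ = q →
      ((reps v κ 0).ncard : ℝ) ≤ K q * √(Fintype.card Z : ℝ) ^ q) (S : Set (ι → Z))
    (hS : ∀ z ∈ S, ∃ I : Finset ι, i₀ ∈ I ∧ r ≤ I.card ∧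
      (fun i : {i // i ∈ I} => z i) ∈ primReps v {i // i ∈ I} ∧
      (fun i : {i // i ∉ I} => z i) ∈ reps v {i // i ∉ I} 0) :
    (S.ncard : ℝ) ≤ 2 ^ Fintype.card ι * (∑ q ∈ Finset.range (Fintype.card ι), (C q : ℝ)) *
      (∑ q ∈ Finset.range (Fintype.card ι), K q) *
      √(Fintype.card Z : ℝ) ^ (Fintype.card ι + 2 - r) := by
  classical
  have h := ncard_le_sum_of_exists S
    (Finset.univ.filter fun I : Finset ι => i₀ ∈ I ∧ r ≤ I.card) (fun I =>
    {z : ι → Z | (fun i : {i // i ∈ I} => z i) ∈ primReps v {i // i ∈ I} ∧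
      (fun i : {i // i ∉ I} => z i) ∈ reps v {i // i ∉ I} 0}) (by
    intro z hz
    obtain ⟨I, h1, h2, h3⟩ := hS z hz
    exact ⟨I, by simp [h1, h2], h3⟩)
  have hsumK : 0 ≤ ∑ q ∈ Finset.range (Fintype.card ι), K q :=
    Finset.sum_nonneg fun q hq => (hK q (Finset.mem_range.1 hq)).1
  refine le_trans (Nat.cast_le.2 h) ?_
  push_cast
  have hterm : ∀ I ∈ (Finset.univ.filter fun I : Finset ι => i₀ ∈ I ∧ r ≤ I.card),
      (({z : ι → Z | (fun i : {i // i ∈ I} => z i) ∈ primReps v {i // i ∈ I} ∧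
      (fun i : {i // i ∉ I} => z i) ∈ reps v {i // i ∉ I} 0}.ncard : ℕ) : ℝ) ≤
      (∑ q ∈ Finset.range (Fintype.card ι), (C q : ℝ)) *
      (∑ q ∈ Finset.range (Fintype.card ι), K q) *
      √(Fintype.card Z : ℝ) ^ (Fintype.card ι + 2 - r) := by
    intro I hI
    obtain ⟨hi, hrI⟩ := (Finset.mem_filter.1 hI).2
    have hIc : I.card ≤ Fintype.card ι := Finset.card_le_univ I
    have hI0 : 0 < I.card := Finset.card_pos.2 ⟨i₀, hi⟩
    have h1 := ncard_prim_reps_le hC ⟨i₀, hi⟩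
    obtain ⟨hKn, hKb⟩ := hK (Fintype.card ι - I.card) (by omega)
    have h2 := hKb {i // i ∉ I} (card_subtype_notMem I)
    have h3 : (C (I.card - 1) : ℝ) ≤ ∑ q ∈ Finset.range (Fintype.card ι), (C q : ℝ) :=
      Finset.single_le_sum (f := fun q => (C q : ℝ)) (fun _ _ => Nat.cast_nonneg _)
        (Finset.mem_range.2 (by omega))
    have h4 : K (Fintype.card ι - I.card) ≤ ∑ q ∈ Finset.range (Fintype.card ι), K q :=
      Finset.single_le_sum (f := K) (fun q hq => (hK q (Finset.mem_range.1 hq)).1)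
        (Finset.mem_range.2 (by omega))
    -- The block costs two square-root factors whatever its size, the complement at most one per
    -- index. This gives the exponent `2 + (card ι - I.card)`, which improves as the block grows.
    have hX : (Fintype.card Z : ℝ) = √(Fintype.card Z : ℝ) ^ 2 :=
      (Real.sq_sqrt (Nat.cast_nonneg _)).symm
    calc (({z : ι → Z | (fun i : {i // i ∈ I} => z i) ∈ primReps v {i // i ∈ I} ∧
          (fun i : {i // i ∉ I} => z i) ∈ reps v {i // i ∉ I} 0}.ncard : ℕ) : ℝ)
        ≤ (Fintype.card Z : ℝ) * C (I.card - 1) * (reps v {i // i ∉ I} 0).ncard := by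
          exact_mod_cast h1
      _ ≤ √(Fintype.card Z : ℝ) ^ 2 * C (I.card - 1) *
          (K (Fintype.card ι - I.card) * √(Fintype.card Z : ℝ) ^ (Fintype.card ι - I.card)) := by
          rw [← hX]; gcongr
      _ = C (I.card - 1) * K (Fintype.card ι - I.card) *
          √(Fintype.card Z : ℝ) ^ (2 + (Fintype.card ι - I.card)) := by rw [pow_add]; ring
      _ ≤ _ := by
          gcongr ?_ * ?_ * ?_
          exact sqrt_card_pow_le (by omega)
  refine (Finset.sum_le_sum hterm).trans ?_
  rw [Finset.sum_const, nsmul_eq_mul, mul_assoc (2 ^ _ * _), mul_assoc (2 ^ _), ← mul_assoc (∑ q ∈ _, (C q : ℝ))]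
  gcongr
  have : (Finset.univ.filter fun I : Finset ι => i₀ ∈ I ∧ r ≤ I.card).card ≤
      2 ^ Fintype.card ι := by
    refine (Finset.card_filter_le _ _).trans ?_
    simp
  exact_mod_cast this

lemma primReps_card_ne_one (hv : ∀ z, v z ≠ 0) {I : Finset ι} {z : ι → Z}
    (hz : (fun i : {i // i ∈ I} => z i) ∈ primReps v {i // i ∈ I}) : I.card ≠ 1 := by
  classical
  intro h
  obtain ⟨i, rfl⟩ := Finset.card_eq_one.1 h
  have h1 := hz.1
  rw [← Finset.sum_subtype {i} (fun _ => Iff.rfl) (fun i => v (z i))] at h1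
  simp only [Finset.sum_singleton] at h1
  exact hv _ h1

/-- Strong induction on `q`, splitting off the minimal vanishing block of one position. No letter
has value zero, so the block has at least two members and its cost fits the square-root budget. -/
lemma exists_reps_zero_bound (C : ℕ → ℕ) : ∃ K : ℕ → ℝ, ∀ q, 0 ≤ K q ∧
    ∀ (Z : Type) [Fintype Z] [Nonempty Z] (v : Z → ℤ), NondegBound v C →
      ∀ (ι : Type) [Fintype ι], Fintype.card ι = q →
      ((reps v ι 0).ncard : ℝ) ≤ K q * √(Fintype.card Z : ℝ) ^ q := by
  suffices H : ∀ q, ∃ K : ℝ, 0 ≤ K ∧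
    ∀ (Z : Type) [Fintype Z] [Nonempty Z] (v : Z → ℤ), NondegBound v C →
      ∀ (ι : Type) [Fintype ι], Fintype.card ι = q →
      ((reps v ι 0).ncard : ℝ) ≤ K * √(Fintype.card Z : ℝ) ^ q by
    choose K hK using H
    exact ⟨K, hK⟩
  intro q
  induction q using Nat.strong_induction_on with
  | _ q ih =>
    have ih' : ∀ q', ∃ K : ℝ, 0 ≤ K ∧ (q' < q →
      ∀ (Z : Type) [Fintype Z] [Nonempty Z] (v : Z → ℤ), NondegBound v C →
      ∀ (ι : Type) [Fintype ι], Fintype.card ι = q' →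
      ((reps v ι 0).ncard : ℝ) ≤ K * √(Fintype.card Z : ℝ) ^ q') := by
      intro q'
      by_cases h : q' < q
      · obtain ⟨K, h1, h2⟩ := ih q' h
        exact ⟨K, h1, fun _ => h2⟩
      · exact ⟨0, le_rfl, fun h' => absurd h' h⟩
    choose K hK0 hK using ih'
    refine ⟨1 + 2 ^ q * (∑ q ∈ Finset.range q, (C q : ℝ)) * (∑ q ∈ Finset.range q, K q), ?_, ?_⟩
    · have : 0 ≤ ∑ q ∈ Finset.range q, K q := Finset.sum_nonneg fun q _ => hK0 q
      positivity
    intro Z _ _ v hC ι _ hq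
    classical
    rcases isEmpty_or_nonempty ι with hι | ⟨⟨i₀⟩⟩
    · have hq0 : q = 0 := by rw [← hq]; exact Fintype.card_eq_zero
      subst hq0
      have : (reps v ι 0).ncard ≤ 1 := by
        rw [Set.ncard_le_one (Set.toFinite _)]
        intro a _ b _
        exact Subsingleton.elim _ _
      simpa using (by exact_mod_cast this : ((reps v ι 0).ncard : ℝ) ≤ 1)
    · have := ncard_large_block_le (r := 2) (K := K) hC i₀ (fun q' hq' =>
        ⟨hK0 q', fun κ _ h => hK q' (hq ▸ hq') Z v hC κ h⟩) (reps v ι 0) (by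
          intro z hz
          obtain ⟨I, h1, h2, h3⟩ := exists_primReps_restrict hz i₀
          refine ⟨I, h1, ?_, h2, h3⟩
          have := primReps_card_ne_one hC.ne_zero h2
          have : 0 < I.card := Finset.card_pos.2 ⟨_, h1⟩
          omega)
      rw [hq] at this
      refine this.trans ?_
      rw [Nat.add_sub_cancel]
      gcongr
      linarith

/-- Take `I` to be a vanishing index set of largest cardinality: a vanishing subsum outside it could
be adjoined. -/
lemma exists_nondegReps_restrict [DecidableEq ι] {b : ℤ} {z : ι → Z} (hz : ∑ i, v (z i) = b) :
    ∃ I : Finset ι, (fun i : {i // i ∈ I} => z i) ∈ reps v {i // i ∈ I} 0 ∧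
      (fun i : {i // i ∉ I} => z i) ∈ nondegReps v {i // i ∉ I} b := by
  classical
  obtain ⟨I, hI, hmax⟩ := Finset.exists_max_image
    (Finset.univ.filter fun I : Finset ι => ∑ i ∈ I, v (z i) = 0) Finset.card
    ⟨∅, by simp⟩
  simp only [Finset.mem_filter, Finset.mem_univ, true_and] at hI hmax
  have hsum : ∑ i : {i // i ∈ I}, v (z i) = 0 := by
    rw [← hI, Finset.sum_subtype I (fun _ => Iff.rfl)]
  refine ⟨I, hsum, ?_, ?_⟩
  · have : ∑ i : {i // i ∈ I}, v (z i) + ∑ i : {i // i ∉ I}, v (z i) = ∑ i, v (z i) :=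
      sum_subtype_add_sum_subtype_not (fun i => v (z i))
    rw [hz, hsum, zero_add] at this
    exact this
  · intro s hs h0
    set t := s.map (Function.Embedding.subtype _) with ht
    have hd : Disjoint I t := by
      rw [Finset.disjoint_right]
      intro i hi
      obtain ⟨j, _, rfl⟩ := Finset.mem_map.1 hi
      exact j.2
    have ht0 : ∑ i ∈ t, v (z i) = 0 := by simpa [ht, Finset.sum_map] using h0
    have h1 := hmax (I ∪ t) (by rw [Finset.sum_union hd, hI, ht0, add_zero])
    rw [Finset.card_union_of_disjoint hd] at h1
    have : 0 < t.card := Finset.card_pos.2 (by simpa [ht] using hs)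
    omega

/-- For `b ≠ 0`, remove a largest vanishing part, counted by `exists_reps_zero_bound`; what remains
is nondegenerate and has boundedly many choices. -/
lemma exists_reps_bound (C : ℕ → ℕ) : ∃ K : ℕ → ℝ, ∀ q, 0 ≤ K q ∧
    ∀ (Z : Type) [Fintype Z] [Nonempty Z] (v : Z → ℤ), NondegBound v C →
      ∀ (ι : Type) [Fintype ι], Fintype.card ι = q → ∀ b,
      ((reps v ι b).ncard : ℝ) ≤ K q * √(Fintype.card Z : ℝ) ^ q := by
  obtain ⟨K, hK⟩ := exists_reps_zero_bound C
  have hK0 : ∀ q, 0 ≤ ∑ q' ∈ Finset.range (q + 1), K q' :=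
    fun q => Finset.sum_nonneg fun q _ => (hK q).1
  refine ⟨fun q => K q + 2 ^ q * (∑ q' ∈ Finset.range (q + 1), K q') *
    (∑ q' ∈ Finset.range (q + 1), (C q' : ℝ)), fun q => ⟨?_, ?_⟩⟩
  · have := hK0 q
    have := (hK q).1
    positivity
  intro Z _ _ v hC ι _ hq b
  classical
  by_cases hb : b = 0
  · subst hb
    refine ((hK q).2 Z v hC ι hq).trans ?_
    gcongr
    have := hK0 q
    have : (0:ℝ) ≤ 2 ^ q * (∑ q' ∈ Finset.range (q + 1), K q') *
      (∑ q' ∈ Finset.range (q + 1), (C q' : ℝ)) := by positivity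
    linarith
  have h := ncard_le_sum_of_exists (reps v ι b) Finset.univ (fun I : Finset ι =>
    {z : ι → Z | (fun i : {i // i ∈ I} => z i) ∈ reps v {i // i ∈ I} 0 ∧
      (fun i : {i // i ∉ I} => z i) ∈ nondegReps v {i // i ∉ I} b}) (fun z hz => by
    obtain ⟨I, h⟩ := exists_nondegReps_restrict hz
    exact ⟨I, Finset.mem_univ _, h⟩)
  refine le_trans (Nat.cast_le.2 h) ?_
  push_cast
  have hterm : ∀ I ∈ (Finset.univ : Finset (Finset ι)),
      (({z : ι → Z | (fun i : {i // i ∈ I} => z i) ∈ reps v {i // i ∈ I} 0 ∧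
      (fun i : {i // i ∉ I} => z i) ∈ nondegReps v {i // i ∉ I} b}.ncard : ℕ) : ℝ) ≤
      (∑ q' ∈ Finset.range (q + 1), K q') * (∑ q' ∈ Finset.range (q + 1), (C q' : ℝ)) *
        √(Fintype.card Z : ℝ) ^ q := by
    intro I _
    have hIc : I.card ≤ q := hq ▸ Finset.card_le_univ I
    have h1 : {z : ι → Z | (fun i : {i // i ∈ I} => z i) ∈ reps v {i // i ∈ I} 0 ∧
      (fun i : {i // i ∉ I} => z i) ∈ nondegReps v {i // i ∉ I} b}.ncard ≤
        (reps v {i // i ∈ I} 0).ncard * C (q - I.card) := by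
      refine ncard_le_mul_of_restrict (fun i => i ∈ I) _ _ _ (fun z hz => hz.1) fun y _ => ?_
      rw [← hq, ← card_subtype_notMem I]
      refine (Set.ncard_le_ncard ?_ (Set.toFinite _)).trans (hC.ncard_le {i // i ∉ I} b hb)
      rintro x ⟨z, hz, rfl, rfl⟩
      exact hz.2
    have h2 := (hK I.card).2 Z v hC {i // i ∈ I} (Fintype.card_coe I)
    have h3 : (C (q - I.card) : ℝ) ≤ ∑ q' ∈ Finset.range (q + 1), (C q' : ℝ) :=
      Finset.single_le_sum (f := fun q => (C q : ℝ)) (fun _ _ => Nat.cast_nonneg _)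
        (Finset.mem_range.2 (by omega))
    have h4 : K I.card ≤ ∑ q' ∈ Finset.range (q + 1), K q' :=
      Finset.single_le_sum (f := K) (fun q _ => (hK q).1) (Finset.mem_range.2 (by omega))
    calc _ ≤ ((reps v {i // i ∈ I} 0).ncard : ℝ) * C (q - I.card) := by exact_mod_cast h1
      _ ≤ (K I.card * √(Fintype.card Z : ℝ) ^ I.card) * C (q - I.card) := by gcongr
      _ ≤ ((∑ q' ∈ Finset.range (q + 1), K q') * √(Fintype.card Z : ℝ) ^ q) *
          (∑ q' ∈ Finset.range (q + 1), (C q' : ℝ)) := by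
          have := hK0 q
          gcongr ?_ * ?_ * ?_
          exact sqrt_card_pow_le hIc
      _ = _ := by ring
  refine (Finset.sum_le_sum hterm).trans ?_
  rw [Finset.sum_const, nsmul_eq_mul]
  have : ((Finset.univ : Finset (Finset ι)).card : ℝ) = 2 ^ q := by simp [hq]
  rw [this]
  have h5 := (hK q).1
  have h6 : 0 ≤ K q * √(Fintype.card Z : ℝ) ^ q := by positivity
  linarith

end Counting

/-! ### The moment recursion -/

section Moments

variable {Z : Type} [Fintype Z] {v : Z → ℤ} {ι : Type} [Fintype ι]

/-- The sum of the weights of all tuples of letters with vanishing value sum. -/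
noncomputable def moment (v : Z → ℤ) (w : Z → ℂ) (ι : Type) [Fintype ι] [DecidableEq ι] : ℂ :=
  ∑ z : ι → Z, if ∑ i, v (z i) = 0 then ∏ i, w (z i) else 0

lemma ncard_fiber_le {C : ℕ → ℕ} (hC : NondegBound v C) {b : ℤ} (hb : b ≠ 0) :
    {a : Z | v a = b}.ncard ≤ C 1 := by
  classical
  have h := hC.ncard_le Unit b hb
  rw [Fintype.card_unit] at h
  refine le_trans ?_ h
  refine Set.ncard_le_ncard_of_injOn (fun a _ => a) ?_ ?_ (Set.toFinite _)
  · intro a ha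
    refine ⟨by simpa using ha, fun s hs => ?_⟩
    obtain ⟨x, hx⟩ := hs
    have : s = Finset.univ := by ext y; simp [Subsingleton.elim y x, hx]
    subst this
    simpa [show v a = b from ha] using hb
  · intro a _ a' _ h
    exact congrFun h ()

lemma ncard_const_le {C : ℕ → ℕ} (hC : NondegBound v C) {b : ℤ} (hb : b ≠ 0) :
    {x : ι → Z | ∀ i, v (x i) = b}.ncard ≤ C 1 ^ Fintype.card ι := by
  classical
  have : {x : ι → Z | ∀ i, v (x i) = b} =
      (Fintype.piFinset fun _ : ι => Finset.univ.filter fun a => v a = b : Finset (ι → Z)) := by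
    ext x; simp
  rw [this, Set.ncard_coe_finset, Fintype.card_piFinset, Finset.prod_const, Finset.card_univ]
  gcongr
  refine le_trans (le_of_eq ?_) (ncard_fiber_le hC hb)
  rw [← Set.ncard_coe_finset]
  simp

/-- Vanishing tuples in which two distinct letters cancel the letter at `i₀`. -/
lemma ncard_two_partners_le [DecidableEq ι] {C : ℕ → ℕ} (hC : NondegBound v C) {i₀ i i' : ι}
    (hi : i ≠ i₀) (hi' : i' ≠ i₀) (hii : i ≠ i') {K : ℝ} (hK : ∀ (κ : Type) [Fintype κ],
      Fintype.card κ = Fintype.card ι - 3 → ∀ b,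
      ((reps v κ b).ncard : ℝ) ≤ K * √(Fintype.card Z : ℝ) ^ (Fintype.card ι - 3)) :
    ({z : ι → Z | ∑ j, v (z j) = 0 ∧ v (z i) + v (z i₀) = 0 ∧ v (z i') + v (z i₀) = 0}.ncard : ℝ) ≤
      C 1 ^ 2 * K * √(Fintype.card Z : ℝ) ^ (Fintype.card ι - 1) := by
  classical
  set I : Finset ι := {i₀, i, i'} with hI
  have hI3 : I.card = 3 := by
    rw [hI, Finset.card_eq_three]
    exact ⟨i₀, i, i', hi.symm, hi'.symm, hii, rfl⟩
  have hq : 3 ≤ Fintype.card ι := hI3 ▸ Finset.card_le_univ I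
  have m₀ : i₀ ∈ I := by simp [hI]
  have m : i ∈ I := by simp [hI]
  have m' : i' ∈ I := by simp [hI]
  set T : Set ({j // j ∈ I} → Z) :=
    {y | v (y ⟨i, m⟩) + v (y ⟨i₀, m₀⟩) = 0 ∧ v (y ⟨i', m'⟩) + v (y ⟨i₀, m₀⟩) = 0}
  have hT : T.ncard ≤ Fintype.card Z * C 1 ^ 2 := by
    have := ncard_le_mul_of_restrict (fun j : {j // j ∈ I} => j = ⟨i₀, m₀⟩) T Set.univ
      (C 1 ^ 2) (fun _ _ => Set.mem_univ _) ?_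
    · refine this.trans (le_of_eq ?_)
      rw [Set.ncard_univ, Nat.card_eq_fintype_card, Fintype.card_fun]
      simp
    · intro y _
      have hcard : Fintype.card {j : {j // j ∈ I} // ¬ j = ⟨i₀, m₀⟩} = 2 := by
        rw [Fintype.card_subtype_compl, Fintype.card_coe, hI3]; simp
      rw [← hcard]
      refine le_trans (Set.ncard_le_ncard ?_ (Set.toFinite _))
        (ncard_const_le hC (neg_ne_zero.2 (hC.ne_zero (y ⟨⟨i₀, m₀⟩, rfl⟩))))
      rintro x ⟨z, ⟨h1, h2⟩, rfl, rfl⟩ ⟨⟨j, hj⟩, hj0⟩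
      simp only [hI, Finset.mem_insert, Finset.mem_singleton] at hj
      rcases hj with rfl | rfl | rfl
      · exact absurd rfl hj0
      · simp only; linarith
      · simp only; linarith
  set r := K * √(Fintype.card Z : ℝ) ^ (Fintype.card ι - 3)
  have hr0 : 0 ≤ r := by
    refine le_trans (Nat.cast_nonneg _) (hK {j // j ∉ I} ?_ 0)
    rw [card_subtype_notMem, hI3]
  -- The letters outside `I` have a prescribed sum, so `r` bounds each fibre; the floor appears
  -- because the fibre bound must be a natural number.
  have h := ncard_le_mul_of_restrict (fun j : ι => j ∈ I)
    {z : ι → Z | ∑ j, v (z j) = 0 ∧ v (z i) + v (z i₀) = 0 ∧ v (z i') + v (z i₀) = 0} T ⌊r⌋₊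
    (fun z hz => hz.2) ?_
  · calc _ ≤ ((T.ncard * ⌊r⌋₊ : ℕ) : ℝ) := by exact_mod_cast h
      _ ≤ ((Fintype.card Z : ℝ) * C 1 ^ 2) * r := by
        rw [Nat.cast_mul]
        gcongr
        · exact_mod_cast hT
        · exact Nat.floor_le hr0
      _ = (√(Fintype.card Z : ℝ) ^ 2 * C 1 ^ 2) * r := by
        rw [Real.sq_sqrt (Nat.cast_nonneg _)]
      _ = _ := by
        rw [show Fintype.card ι - 1 = 2 + (Fintype.card ι - 3) by omega, pow_add]
        ring
  · intro y _
    refine Nat.le_floor (le_trans ?_ (hK {j // j ∉ I}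
      (by rw [card_subtype_notMem, hI3]) (-∑ j, v (y j))))
    rw [Nat.cast_le]
    refine Set.ncard_le_ncard ?_ (Set.toFinite _)
    rintro x ⟨z, hz, rfl, rfl⟩
    have : ∑ j : {j // j ∈ I}, v (z j) + ∑ j : {j // j ∉ I}, v (z j) = ∑ j, v (z j) :=
      sum_subtype_add_sum_subtype_not (fun i => v (z i))
    have h0 := hz.1
    simp only [reps, Set.mem_ofPred_eq]
    linarith

lemma moment_mul_moment_compl [DecidableEq ι] (v : Z → ℤ) (w : Z → ℂ) (I : Finset ι) :
    moment v w {i // i ∈ I} * moment v w {i // i ∉ I} =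
      ∑ z : ι → Z, if ∑ i ∈ I, v (z i) = 0 ∧ ∑ i, v (z i) = 0 then ∏ i, w (z i) else 0 := by
  unfold moment
  rw [Fintype.sum_mul_sum, ← Fintype.sum_prod_type']
  symm
  refine Fintype.sum_equiv (Equiv.piEquivPiSubtypeProd (fun i => i ∈ I) (fun _ => Z)) _ _ ?_
  intro z
  have h1 : ∑ j : {j // j ∈ I}, v (z j) + ∑ j : {j // j ∉ I}, v (z j) = ∑ j, v (z j) :=
    sum_subtype_add_sum_subtype_not (fun i => v (z i))
  have h2 : (∏ j : {j // j ∈ I}, w (z j)) * ∏ j : {j // j ∉ I}, w (z j) = ∏ j, w (z j) := by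
    rw [← Fintype.prod_subtype_mul_prod_subtype (fun j => j ∈ I) (fun j => w (z j))]
    congr!
  have h3 : ∑ i ∈ I, v (z i) = ∑ j : {j // j ∈ I}, v (z j) :=
    Finset.sum_subtype I (fun _ => Iff.rfl) _
  simp only [Equiv.piEquivPiSubtypeProd_apply]
  rw [← h1, ← h2, h3]
  split_ifs <;> simp_all

lemma norm_moment_le [DecidableEq ι] {w : Z → ℂ} {W : ℝ} (hw : ∀ z, ‖w z‖ ≤ W) :
    ‖moment v w ι‖ ≤ W ^ Fintype.card ι * (reps v ι 0).ncard := by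
  unfold moment
  rw [← Finset.sum_filter]
  refine (norm_sum_le _ _).trans ?_
  refine (Finset.sum_le_card_nsmul _ _ (W ^ Fintype.card ι) ?_).trans ?_
  · intro z _
    rw [norm_prod]
    refine (Finset.prod_le_prod (fun i _ => norm_nonneg _) fun i _ => hw (z i)).trans ?_
    simp
  · rw [nsmul_eq_mul, mul_comm]
    apply le_of_eq
    congr 2
    rw [← Set.ncard_coe_finset]
    congr 1
    ext z
    simp [reps]

/-- If no letter cancels the one at `i₀`, its minimal block is neither a singleton nor a pair.
Having at least three members, it saves one square root of `card Z`. -/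
lemma ncard_no_partner_le [DecidableEq ι] {C : ℕ → ℕ} [Nonempty Z] (hC : NondegBound v C) (i₀ : ι)
    {K : ℕ → ℝ} (hK : ∀ q < Fintype.card ι, 0 ≤ K q ∧
      ∀ (κ : Type) [Fintype κ], Fintype.card κ = q →
      ((reps v κ 0).ncard : ℝ) ≤ K q * √(Fintype.card Z : ℝ) ^ q) :
    ({z : ι → Z | ∑ j, v (z j) = 0 ∧ ∀ i ≠ i₀, v (z i) + v (z i₀) ≠ 0}.ncard : ℝ) ≤
      2 ^ Fintype.card ι * (∑ q ∈ Finset.range (Fintype.card ι), (C q : ℝ)) *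
      (∑ q ∈ Finset.range (Fintype.card ι), K q) *
      √(Fintype.card Z : ℝ) ^ (Fintype.card ι - 1) := by
  refine ncard_large_block_le (r := 3) hC i₀ hK _ fun z hz => ?_
  obtain ⟨I, h1, h2, h3⟩ := exists_primReps_restrict hz.1 i₀
  refine ⟨I, h1, ?_, h2, h3⟩
  have := primReps_card_ne_one hC.ne_zero h2
  have : 0 < I.card := Finset.card_pos.2 ⟨_, h1⟩
  have : I.card ≠ 2 := by
    intro h
    obtain ⟨a, b, hab, rfl⟩ := Finset.card_eq_two.1 h
    have hs := h2.1
    rw [← Finset.sum_subtype {a, b} (fun _ => Iff.rfl) (fun i => v (z i)),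
      Finset.sum_pair hab] at hs
    simp only [Finset.mem_insert, Finset.mem_singleton] at h1
    rcases h1 with rfl | rfl
    · exact hz.2 b hab.symm (by linarith)
    · exact hz.2 a hab hs
  omega

/-- An approximate Wick formula: up to lower order, the position `i₀` is paired with exactly one
other position. The exceptional tuples have no partner of `i₀` or at least two. -/
lemma exists_moment_recursion_bound (C : ℕ → ℕ) : ∃ K : ℕ → ℝ, ∀ q, 0 ≤ K q ∧
    ∀ (Z : Type) [Fintype Z] [Nonempty Z] (v : Z → ℤ), NondegBound v C →
      ∀ (w : Z → ℂ) (W : ℝ), (∀ z, ‖w z‖ ≤ W) →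
      ∀ (ι : Type) [Fintype ι] [DecidableEq ι], Fintype.card ι = q → ∀ i₀ : ι,
      ‖moment v w ι - ∑ i ∈ Finset.univ.erase i₀,
        moment v w {j // j ∈ ({i, i₀} : Finset ι)} * moment v w {j // j ∉ ({i, i₀} : Finset ι)}‖ ≤
        K q * W ^ q * √(Fintype.card Z : ℝ) ^ (q - 1) := by
  obtain ⟨K, hK⟩ := exists_reps_bound C
  have hK0 : ∀ q, 0 ≤ ∑ q' ∈ Finset.range q, K q' :=
    fun q => Finset.sum_nonneg fun q _ => (hK q).1
  set L : ℕ → ℝ := fun q => 2 ^ q * (∑ q' ∈ Finset.range q, (C q' : ℝ)) *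
    (∑ q' ∈ Finset.range q, K q') + q * q * (C 1 ^ 2 * K (q - 3)) with hL
  have hL0 : ∀ q, 0 ≤ L q := by
    intro q
    have := hK0 q
    have := (hK (q - 3)).1
    positivity
  refine ⟨fun q => q * L q, fun q => ⟨mul_nonneg (Nat.cast_nonneg _) (hL0 q), ?_⟩⟩
  intro Z _ _ v hC w W hw ι _ _ hq i₀
  have hW : 0 ≤ W := (norm_nonneg _).trans (hw (Classical.arbitrary Z))
  set P : (ι → Z) → Finset ι := fun z =>
    (Finset.univ.erase i₀).filter fun i => v (z i) + v (z i₀) = 0 with hP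
  set S : Set (ι → Z) := {z | ∑ j, v (z j) = 0 ∧ (P z).card ≠ 1} with hS
  -- The product of moments for `i` collects the vanishing tuples in which `i` is a partner of `i₀`.
  -- The sum over `i` counts `z` with multiplicity `(P z).card`, so tuples with exactly one partner
  -- cancel.
  have hdiff : moment v w ι - ∑ i ∈ Finset.univ.erase i₀,
        moment v w {j // j ∈ ({i, i₀} : Finset ι)} * moment v w {j // j ∉ ({i, i₀} : Finset ι)} =
      ∑ z ∈ S.toFinite.toFinset, (1 - ((P z).card : ℂ)) * ∏ i, w (z i) := by
    have h1 : ∀ i ∈ Finset.univ.erase i₀, moment v w {j // j ∈ ({i, i₀} : Finset ι)} *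
        moment v w {j // j ∉ ({i, i₀} : Finset ι)} =
        ∑ z : ι → Z, if v (z i) + v (z i₀) = 0 then
          (if ∑ i, v (z i) = 0 then ∏ i, w (z i) else 0) else 0 := by
      intro i hi
      rw [moment_mul_moment_compl]
      refine Finset.sum_congr rfl fun z _ => ?_
      rw [Finset.sum_pair (Finset.ne_of_mem_erase hi), ite_and]
    rw [Finset.sum_congr rfl h1, Finset.sum_comm, moment, ← Finset.sum_sub_distrib]
    have hSf : S.toFinite.toFinset = Finset.univ.filter fun z => z ∈ S := by ext; simp; exact Iff.rfl
    rw [hSf, Finset.sum_filter]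
    refine Finset.sum_congr rfl fun z _ => ?_
    rw [← Finset.sum_filter, Finset.sum_const, nsmul_eq_mul]
    change _ - ((P z).card : ℂ) * _ = _
    by_cases h0 : ∑ i, v (z i) = 0
    · by_cases h1 : (P z).card = 1
      · simp [hS, h0, h1]
      · simp only [hS, h0, h1, if_true, Set.mem_ofPred_eq, not_false_iff, and_self, ne_eq]
        ring
    · simp [hS, h0]
  have hcardS : (S.ncard : ℝ) ≤ L q * √(Fintype.card Z : ℝ) ^ (q - 1) := by
    have hsub : S ⊆ {z : ι → Z | ∑ j, v (z j) = 0 ∧ ∀ i ≠ i₀, v (z i) + v (z i₀) ≠ 0} ∪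
        {z | ∃ ij ∈ (Finset.univ.filter fun ij : ι × ι => ij.1 ≠ i₀ ∧ ij.2 ≠ i₀ ∧ ij.1 ≠ ij.2),
          z ∈ {z : ι → Z | ∑ j, v (z j) = 0 ∧ v (z ij.1) + v (z i₀) = 0 ∧
            v (z ij.2) + v (z i₀) = 0}} := by
      intro z hz
      rcases Nat.lt_or_ge (P z).card 1 with h | h
      · left
        refine ⟨hz.1, fun i hi h0 => ?_⟩
        have : i ∈ P z := by simp [hP, hi, h0]
        have := Finset.card_pos.2 ⟨i, this⟩
        omega
      · right
        have h2 : 1 < (P z).card := lt_of_le_of_ne h (Ne.symm hz.2)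
        obtain ⟨i, hi, i', hi', hne⟩ := Finset.one_lt_card.1 h2
        simp only [hP, Finset.mem_filter, Finset.mem_erase, Finset.mem_univ, and_true] at hi hi'
        exact ⟨(i, i'), by simp [hi.1, hi'.1, hne], hz.1, hi.2, hi'.2⟩
    have h1 := (Set.ncard_le_ncard hsub (Set.toFinite _)).trans (Set.ncard_union_le _ _)
    have h2 := ncard_no_partner_le hC i₀ (K := K) (fun q _ => ⟨(hK q).1,
      fun κ _ h => (hK q).2 Z v hC κ h 0⟩)
    have h3 := ncard_le_sum_of_exists _
      (Finset.univ.filter fun ij : ι × ι => ij.1 ≠ i₀ ∧ ij.2 ≠ i₀ ∧ ij.1 ≠ ij.2)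
      (fun ij => {z : ι → Z | ∑ j, v (z j) = 0 ∧ v (z ij.1) + v (z i₀) = 0 ∧
            v (z ij.2) + v (z i₀) = 0}) (fun z (hz : z ∈ {z : ι → Z | ∃ ij ∈ (Finset.univ.filter
            fun ij : ι × ι => ij.1 ≠ i₀ ∧ ij.2 ≠ i₀ ∧ ij.1 ≠ ij.2),
          z ∈ {z : ι → Z | ∑ j, v (z j) = 0 ∧ v (z ij.1) + v (z i₀) = 0 ∧
            v (z ij.2) + v (z i₀) = 0}}) => hz)
    have h4 : ((∑ ij ∈ (Finset.univ.filter fun ij : ι × ι =>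
        ij.1 ≠ i₀ ∧ ij.2 ≠ i₀ ∧ ij.1 ≠ ij.2), {z : ι → Z | ∑ j, v (z j) = 0 ∧
          v (z ij.1) + v (z i₀) = 0 ∧ v (z ij.2) + v (z i₀) = 0}.ncard : ℕ) : ℝ) ≤
        q * q * (C 1 ^ 2 * K (q - 3) * √(Fintype.card Z : ℝ) ^ (q - 1)) := by
      push_cast
      refine (Finset.sum_le_card_nsmul _ _
        (C 1 ^ 2 * K (q - 3) * √(Fintype.card Z : ℝ) ^ (q - 1)) ?_).trans ?_
      · intro ij hij
        obtain ⟨ha, hb, hc⟩ := (Finset.mem_filter.1 hij).2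
        rw [← hq]
        exact ncard_two_partners_le hC ha hb hc (fun κ _ h b => (hK _).2 Z v hC κ h b)
      · rw [nsmul_eq_mul]
        have h5 := (hK (q - 3)).1
        gcongr
        refine (Nat.cast_le.2 (Finset.card_filter_le _ _)).trans ?_
        simp [hq]
    rw [hq] at h2
    have h1' := (Nat.cast_le (α := ℝ)).2 h1
    rw [Nat.cast_add] at h1'
    have h3' := (Nat.cast_le (α := ℝ)).2 h3
    rw [hL]
    simp only
    rw [add_mul]
    linarith
  rw [hdiff]
  refine (norm_sum_le _ _).trans ?_
  refine (Finset.sum_le_card_nsmul _ _ (q * W ^ q) ?_).trans ?_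
  · intro z _
    rw [norm_mul]
    have hc : (P z).card ≤ q - 1 := by
      refine (Finset.card_filter_le _ _).trans ?_
      rw [Finset.card_erase_of_mem (Finset.mem_univ _), Finset.card_univ, hq]
    have hq1 : 1 ≤ q := hq ▸ Fintype.card_pos_iff.2 ⟨i₀⟩
    gcongr
    · have : (1 - ((P z).card : ℂ)) = ((1 - ((P z).card : ℝ) : ℝ) : ℂ) := by push_cast; rfl
      rw [this, Complex.norm_real, Real.norm_eq_abs, abs_le]
      have h1 : ((P z).card : ℝ) ≤ q := by exact_mod_cast hc.trans (Nat.sub_le _ _)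
      have h2 : (1 : ℝ) ≤ q := by exact_mod_cast hq1
      have h3 : (0 : ℝ) ≤ (P z).card := Nat.cast_nonneg _
      constructor <;> linarith
    · rw [norm_prod]
      refine (Finset.prod_le_prod (fun i _ => norm_nonneg _) fun i _ => hw (z i)).trans ?_
      simp [hq]
  · rw [nsmul_eq_mul, ← Set.ncard_eq_toFinset_card]
    calc (S.ncard : ℝ) * (q * W ^ q) ≤ (L q * √(Fintype.card Z : ℝ) ^ (q - 1)) * (q * W ^ q) := by
          gcongr
      _ = _ := by ring

end Moments

/-! ### From the conditions `A_p` to letters with values `j * n k` -/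

/-- The nonzero integers of absolute value at most `J`. -/
noncomputable def freqs (J : ℕ) : Finset ℤ := (Finset.Icc (-(J : ℤ)) J).erase 0

lemma ne_zero_of_mem_freqs {J : ℕ} {j : ℤ} (h : j ∈ freqs J) : j ≠ 0 := Finset.ne_of_mem_erase h

/-- The values `j * n k` of the letters `(j, k)`. -/
def letterVal (n : ℕ → ℕ) (D : Finset ℤ) (F : Finset ℕ) (z : {x // x ∈ D ×ˢ F}) : ℤ :=
  z.1.1 * n z.1.2

lemma conditionA_zero (n : ℕ → ℕ) : ConditionA n 0 := by
  refine ⟨1, le_rfl, fun b hb a _ => ?_⟩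
  have : {k : Fin 0 → ℕ | IsNondegenerateSolution n a b k} = ∅ := by
    ext k
    simp [IsNondegenerateSolution, hb.symm]
  simp [this]

lemma conditionA_one {n : ℕ → ℕ} (hn : Function.Injective n) : ConditionA n 1 := by
  refine ⟨1, le_rfl, fun b _ a ha => ?_⟩
  rw [Nat.cast_one, Set.encard_le_one_iff]
  rintro k k' ⟨h, _⟩ ⟨h', _⟩
  simp only [Finset.univ_unique, Fin.default_eq_zero, Finset.sum_singleton] at h h'
  funext i
  rw [Subsingleton.elim i 0]
  exact hn (by exact_mod_cast mul_left_cancel₀ (ha 0) (h.trans h'.symm))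

/-- Choose the frequencies first, in at most `D.card ^ p` ways; they serve as the coefficients in
`A_p`, which then bounds the choices of indices. The bound does not depend on `F`. The cases `p = 0,
1` hold trivially and by injectivity of `n`. -/
lemma exists_nondegBound {n : ℕ → ℕ} (hpos : ∀ k, 0 < n k) (hmono : StrictMono n)
    (hA : ∀ p : ℕ, 2 ≤ p → ConditionA n p) {D : Finset ℤ} (hD : ∀ j ∈ D, j ≠ 0) :
    ∃ C : ℕ → ℕ, ∀ F, NondegBound (letterVal n D F) C := by
  classical
  have hA' : ∀ p, ConditionA n p := by
    intro p
    rcases p with _ | _ | p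
    · exact conditionA_zero n
    · exact conditionA_one hmono.injective
    · exact hA _ (by omega)
  choose C _ hC using hA'
  refine ⟨fun p => C p * D.card ^ p, fun F => ⟨?_, ?_⟩⟩
  · intro z
    refine mul_ne_zero (hD _ (Finset.mem_product.1 z.2).1) ?_
    exact_mod_cast (hpos _).ne'
  · intro κ _ b hb
    set S := nondegReps (letterVal n D F) κ b
    have hS := S.toFinite
    rw [Set.ncard_eq_toFinset_card S hS]
    have himg : hS.toFinset.image (fun z => fun i : κ => (z i).1.1) ⊆
        Fintype.piFinset fun _ : κ => D := by
      intro a ha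
      obtain ⟨z, _, rfl⟩ := Finset.mem_image.1 ha
      rw [Fintype.mem_piFinset]
      exact fun i => (Finset.mem_product.1 (z i).2).1
    refine (Finset.card_le_mul_card_image (f := fun z => fun i : κ => (z i).1.1)
      hS.toFinset (C (Fintype.card κ)) ?_).trans ?_
    · intro a ha
      have haD : ∀ i, a i ≠ 0 := fun i => hD _ (Fintype.mem_piFinset.1 (himg ha) i)
      let e := Fintype.equivFin κ
      have h := hC (Fintype.card κ) b hb (fun j => a (e.symm j)) (fun j => haD _)
      have hfin := Set.finite_of_encard_le_coe h
      rw [← hfin.cast_ncard_eq, Nat.cast_le] at h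
      refine le_trans ?_ h
      rw [← Set.ncard_coe_finset]
      refine Set.ncard_le_ncard_of_injOn (fun z => fun j => (z (e.symm j)).1.2) ?_ ?_ hfin
      · intro z hz
        simp only [Finset.coe_filter, Set.Finite.mem_toFinset, Set.mem_ofPred_eq] at hz
        obtain ⟨⟨hz1, hz2⟩, rfl⟩ := hz
        refine ⟨?_, fun s hs h0 => ?_⟩
        · rw [← hz1]
          exact Equiv.sum_comp e.symm (fun i => letterVal n D F (z i))
        · refine hz2 (s.map e.symm.toEmbedding) (by simpa using hs) ?_
          rw [Finset.sum_map]
          exact h0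
      · intro z hz z' hz' hzz
        simp only [Finset.coe_filter, Set.Finite.mem_toFinset, Set.mem_ofPred_eq] at hz hz'
        funext i
        refine Subtype.ext (Prod.ext ?_ ?_)
        · exact congrFun (hz.2.trans hz'.2.symm) i
        · simpa using congrFun hzz (e i)
    · gcongr
      refine (Finset.card_le_card himg).trans (le_of_eq ?_)
      simp

/-! ### Trigonometric sums and orthogonality -/

section TrigonometricSums

/-- The character `x ↦ exp (2 π i m x)`. -/
noncomputable def trigChar (m : ℤ) (x : ℝ) : ℂ := Complex.exp (2 * Real.pi * Complex.I * m * x)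

lemma trigChar_zero (x : ℝ) : trigChar 0 x = 1 := by simp [trigChar]

lemma trigChar_add (m m' : ℤ) (x : ℝ) : trigChar (m + m') x = trigChar m x * trigChar m' x := by
  rw [trigChar, trigChar, trigChar, ← Complex.exp_add]
  congr 1
  push_cast
  ring

lemma trigChar_sum {ι : Type} (s : Finset ι) (m : ι → ℤ) (x : ℝ) :
    trigChar (∑ i ∈ s, m i) x = ∏ i ∈ s, trigChar (m i) x := by
  classical
  induction s using Finset.induction_on with
  | empty => simp [trigChar_zero]
  | insert a s ha ih => rw [Finset.sum_insert ha, Finset.prod_insert ha, trigChar_add, ih]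

lemma star_trigChar (m : ℤ) (x : ℝ) : (starRingEnd ℂ) (trigChar m x) = trigChar (-m) x := by
  rw [trigChar, trigChar, ← Complex.exp_conj]
  congr 1
  simp [Complex.conj_ofNat]

lemma norm_trigChar (m : ℤ) (x : ℝ) : ‖trigChar m x‖ = 1 := by
  rw [trigChar, show 2 * (Real.pi : ℂ) * Complex.I * m * x =
    ((2 * Real.pi * m * x : ℝ) : ℂ) * Complex.I by push_cast; ring]
  exact Complex.norm_exp_ofReal_mul_I _

lemma trigChar_mul_nat (m : ℤ) (k : ℕ) (x : ℝ) : trigChar m (k * x) = trigChar (m * k) x := by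
  rw [trigChar, trigChar]
  congr 1
  push_cast
  ring

@[fun_prop]
lemma continuous_trigChar (m : ℤ) : Continuous (trigChar m) := by
  unfold trigChar
  fun_prop

lemma lebesgueUnit_eq_restrict_Ioc : lebesgueUnit = volume.restrict (Set.Ioc 0 1) := by
  rw [lebesgueUnit, restrict_Ioo_eq_restrict_Ioc]

lemma integral_lebesgueUnit {E : Type} [NormedAddCommGroup E] [NormedSpace ℝ E] (g : ℝ → E) :
    ∫ x, g x ∂lebesgueUnit = ∫ x in (0 : ℝ)..1, g x := by
  rw [intervalIntegral.integral_of_le zero_le_one, lebesgueUnit_eq_restrict_Ioc]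

lemma integrable_of_continuous {E : Type} [NormedAddCommGroup E] {g : ℝ → E}
    (hg : Continuous g) : Integrable g lebesgueUnit := by
  rw [lebesgueUnit_eq_restrict_Ioc]
  exact (hg.integrableOn_Icc (a := 0) (b := 1)).mono_set Set.Ioc_subset_Icc_self

lemma integral_trigChar (m : ℤ) :
    ∫ x, trigChar m x ∂lebesgueUnit = if m = 0 then 1 else 0 := by
  rw [integral_lebesgueUnit]
  split_ifs with h
  · subst h; simp [trigChar_zero]
  · unfold trigChar
    have hc : 2 * (Real.pi : ℂ) * Complex.I * m ≠ 0 := by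
      simp [Real.pi_ne_zero, h]
    rw [integral_exp_mul_complex hc]
    have : Complex.exp (2 * (Real.pi : ℂ) * Complex.I * m) = 1 := by
      rw [mul_comm, Complex.exp_int_mul_two_pi_mul_I]
    simp [this]

variable {Z : Type} [Fintype Z]

/-- The trigonometric sum with frequencies `v z` and coefficients `w z`. -/
noncomputable def trigSum (v : Z → ℤ) (w : Z → ℂ) (x : ℝ) : ℂ := ∑ z, w z * trigChar (v z) x

@[fun_prop]
lemma continuous_trigSum (v : Z → ℤ) (w : Z → ℂ) : Continuous (trigSum v w) := by
  unfold trigSum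
  fun_prop

lemma integral_trigSum_pow (v : Z → ℤ) (w : Z → ℂ) (ι : Type) [Fintype ι] [DecidableEq ι] :
    ∫ x, trigSum v w x ^ Fintype.card ι ∂lebesgueUnit = moment v w ι := by
  have h : ∀ x, trigSum v w x ^ Fintype.card ι =
      ∑ z : ι → Z, (∏ i, w (z i)) * trigChar (∑ i, v (z i)) x := by
    intro x
    rw [← Finset.card_univ, ← Finset.prod_const]
    unfold trigSum
    rw [Finset.prod_univ_sum, Fintype.piFinset_univ]
    refine Finset.sum_congr rfl fun z _ => ?_
    rw [Finset.prod_mul_distrib, trigChar_sum]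
  simp_rw [h]
  rw [integral_finsetSum _ fun z _ => integrable_of_continuous (by fun_prop)]
  refine Finset.sum_congr rfl fun z _ => ?_
  rw [integral_const_mul, integral_trigChar]
  simp

/-- The mean square of a trigonometric sum. -/
lemma integral_norm_trigSum_sq (v : Z → ℤ) (w : Z → ℂ) :
    ∫ x, ((‖trigSum v w x‖ ^ 2 : ℝ) : ℂ) ∂lebesgueUnit =
      ∑ z, ∑ z', if v z = v z' then w z * (starRingEnd ℂ) (w z') else 0 := by
  have h : ∀ x, ((‖trigSum v w x‖ ^ 2 : ℝ) : ℂ) =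
      ∑ z, ∑ z', w z * (starRingEnd ℂ) (w z') * trigChar (v z - v z') x := by
    intro x
    rw [Complex.ofReal_pow, ← Complex.mul_conj']
    unfold trigSum
    rw [map_sum, Finset.sum_mul_sum]
    refine Finset.sum_congr rfl fun z _ => Finset.sum_congr rfl fun z' _ => ?_
    rw [map_mul, star_trigChar, sub_eq_add_neg, trigChar_add]
    ring
  simp_rw [h]
  rw [integral_finsetSum _ fun z _ => integrable_of_continuous (by fun_prop)]
  refine Finset.sum_congr rfl fun z _ => ?_
  rw [integral_finsetSum _ fun z _ => integrable_of_continuous (by fun_prop)]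
  refine Finset.sum_congr rfl fun z' _ => ?_
  rw [integral_const_mul, integral_trigChar]
  simp [sub_eq_zero]

end TrigonometricSums

/-! ### Taylor remainder of the exponential -/

section TaylorExp

lemma hasDerivAt_sum_pow_div_factorial (x : ℂ) (n : ℕ) (s : ℝ) :
    HasDerivAt (fun s : ℝ => ∑ m ∈ Finset.range (n + 1), ((s : ℂ) * x) ^ m / (m.factorial : ℂ))
      (x * ∑ m ∈ Finset.range n, ((s : ℂ) * x) ^ m / (m.factorial : ℂ)) s := by
  have h0 : HasDerivAt (fun s : ℝ => (s : ℂ) * x) x s := by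
    simpa using (Complex.ofRealCLM.hasDerivAt (x := s)).mul_const x
  have h1 : ∀ m ∈ Finset.range (n + 1), HasDerivAt
      (fun s : ℝ => ((s : ℂ) * x) ^ m / (m.factorial : ℂ))
      ((m : ℂ) * ((s : ℂ) * x) ^ (m - 1) * x / (m.factorial : ℂ)) s := by
    intro m _
    exact (h0.pow m).div_const _
  have h2 := HasDerivAt.fun_sum h1
  refine h2.congr_deriv ?_
  rw [Finset.sum_range_succ', Finset.mul_sum]
  simp only [Nat.cast_zero, zero_mul, zero_div, add_zero, Nat.add_sub_cancel]
  refine Finset.sum_congr rfl fun m _ => ?_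
  rw [Nat.factorial_succ]
  have : (m.factorial : ℂ) ≠ 0 := by exact_mod_cast m.factorial_ne_zero
  have h3 : ((m : ℂ) + 1) ≠ 0 := by exact_mod_cast m.succ_ne_zero
  push_cast
  field_simp

/-- Taylor's formula for the exponential on the left half plane. -/
lemma norm_exp_sub_sum_le {x : ℂ} (hx : x.re ≤ 0) (n : ℕ) :
    ‖Complex.exp x - ∑ m ∈ Finset.range n, x ^ m / (m.factorial : ℂ)‖ ≤
      ‖x‖ ^ n / (n.factorial : ℝ) := by
  -- Along the segment `s * x`, the derivative of each remainder is `x` times the preceding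
  -- remainder, so the bounds integrate up by induction from `‖exp (s * x)‖ ≤ 1`.
  suffices H : ∀ s ∈ Set.Icc (0 : ℝ) 1, ‖Complex.exp (s * x) -
      ∑ m ∈ Finset.range n, ((s : ℂ) * x) ^ m / (m.factorial : ℂ)‖ ≤
      ‖x‖ ^ n * s ^ n / (n.factorial : ℝ) by
    simpa using H 1 (by simp)
  induction n with
  | zero =>
    intro s hs
    simp only [Finset.range_zero, Finset.sum_empty, sub_zero, pow_zero, Nat.factorial_zero,
      Nat.cast_one, div_one, one_mul, Complex.norm_exp]
    rw [Real.exp_le_one_iff]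
    simpa using mul_nonpos_of_nonneg_of_nonpos hs.1 hx
  | succ n ih =>
    have h0 : ∀ s : ℝ, HasDerivAt (fun s : ℝ => (s : ℂ) * x) x s := fun s => by
      simpa using (Complex.ofRealCLM.hasDerivAt (x := s)).mul_const x
    have hd : ∀ s : ℝ, HasDerivAt (fun s : ℝ => Complex.exp (s * x) -
        ∑ m ∈ Finset.range (n + 1), ((s : ℂ) * x) ^ m / (m.factorial : ℂ))
        (x * (Complex.exp (s * x) -
          ∑ m ∈ Finset.range n, ((s : ℂ) * x) ^ m / (m.factorial : ℂ))) s := by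
      intro s
      refine ((h0 s).cexp.fun_sub (hasDerivAt_sum_pow_div_factorial x n s)).congr_deriv ?_
      ring
    have hB : ∀ s : ℝ, HasDerivAt (fun s : ℝ => ‖x‖ ^ (n + 1) * s ^ (n + 1) /
        ((n + 1).factorial : ℝ)) (‖x‖ * (‖x‖ ^ n * s ^ n / (n.factorial : ℝ))) s := by
      intro s
      refine (((hasDerivAt_pow (n + 1) s).const_mul (‖x‖ ^ (n + 1))).div_const
        ((n + 1).factorial : ℝ)).congr_deriv ?_
      rw [Nat.factorial_succ]
      have : (n.factorial : ℝ) ≠ 0 := by exact_mod_cast n.factorial_ne_zero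
      have h3 : ((n : ℝ) + 1) ≠ 0 := by exact_mod_cast n.succ_ne_zero
      rw [Nat.add_sub_cancel]
      push_cast
      field_simp
      ring
    refine image_norm_le_of_norm_deriv_right_le_deriv_boundary
      (fun s _ => (hd s).continuousAt.continuousWithinAt) (fun s _ => (hd s).hasDerivWithinAt)
      ?_ hB ?_
    · rw [Finset.sum_range_succ']
      simp
    · intro s hs
      rw [norm_mul]
      gcongr
      exact ih s ⟨hs.1, hs.2.le⟩

end TaylorExp

/-! ### Gaussian moments -/

section GaussMoment

/-- The moments of the centered normal distribution with variance `V`. -/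
noncomputable def gaussMoment (V : ℝ) : ℕ → ℝ
  | 0 => 1
  | 1 => 0
  | (q + 2) => (q + 1) * V * gaussMoment V q

lemma gaussMoment_odd (V : ℝ) (m : ℕ) : gaussMoment V (2 * m + 1) = 0 := by
  induction m with
  | zero => rfl
  | succ m ih =>
    rw [show 2 * (m + 1) + 1 = (2 * m + 1) + 2 by ring, gaussMoment, ih, mul_zero]

lemma gaussMoment_even (V : ℝ) (m : ℕ) :
    gaussMoment V (2 * m) / ((2 * m).factorial : ℝ) = (V / 2) ^ m / (m.factorial : ℝ) := by
  induction m with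
  | zero => simp [gaussMoment]
  | succ m ih =>
    have h1 : ((2 * m).factorial : ℝ) ≠ 0 := by exact_mod_cast (2 * m).factorial_ne_zero
    have h2 : (m.factorial : ℝ) ≠ 0 := by exact_mod_cast m.factorial_ne_zero
    have h3 : ((m : ℝ) + 1) ≠ 0 := by exact_mod_cast m.succ_ne_zero
    have h4 : (2 * (m : ℝ) + 1) ≠ 0 := by positivity
    have h5 : (2 * (m : ℝ) + 2) ≠ 0 := by positivity
    have ih' : gaussMoment V (2 * m) = (V / 2) ^ m / (m.factorial : ℝ) * (2 * m).factorial := by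
      rw [← ih]; field_simp
    rw [show 2 * (m + 1) = 2 * m + 2 by ring, gaussMoment, ih', Nat.factorial_succ,
      Nat.factorial_succ, Nat.factorial_succ]
    push_cast
    field_simp
    ring

/-- Odd moments vanish, so `2 * P` terms of the moment series are `P` terms of the exponential
series at `-(t ^ 2 * V / 2)`. -/
lemma sum_gaussMoment (V t : ℝ) (P : ℕ) :
    ∑ q ∈ Finset.range (2 * P), (t * Complex.I) ^ q / (q.factorial : ℂ) * (gaussMoment V q : ℂ) =
      ∑ m ∈ Finset.range P, ((-(t ^ 2 * V / 2) : ℝ) : ℂ) ^ m / (m.factorial : ℂ) := by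
  induction P with
  | zero => simp
  | succ P ih =>
    rw [show 2 * (P + 1) = 2 * P + 1 + 1 by ring, Finset.sum_range_succ, Finset.sum_range_succ,
      Finset.sum_range_succ, ih, gaussMoment_odd]
    have h := congrArg Complex.ofReal (gaussMoment_even V P)
    push_cast at h
    rw [Complex.ofReal_zero, mul_zero, add_zero]
    congr 1
    calc _ = (t * Complex.I) ^ (2 * P) * ((gaussMoment V (2 * P) : ℂ) / ((2 * P).factorial : ℂ)) := by
          ring
      _ = _ := by
          rw [h, pow_mul, mul_pow, Complex.I_sq]
          rw [← mul_div_assoc, ← mul_pow]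
          congr 2
          push_cast
          ring

end GaussMoment

/-! ### Characteristic functions of trigonometric sums -/

section CharFun

/-- A real valued trigonometric sum whose frequencies satisfy the counting bounds `C` and whose
coefficients are bounded by `W`. -/
structure IsRealTrigSum (C : ℕ → ℕ) (W : ℝ) {Z : Type} [Fintype Z] (v : Z → ℤ) (w : Z → ℂ)
    (S : ℝ → ℝ) : Prop where
  nondegBound : NondegBound v C
  norm_le : ∀ z, ‖w z‖ ≤ W
  eq_trigSum : ∀ x, (S x : ℂ) = trigSum v w x

variable {C : ℕ → ℕ} {W : ℝ} {Z : Type} [Fintype Z] {v : Z → ℤ} {w : Z → ℂ} {S : ℝ → ℝ}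

lemma IsRealTrigSum.continuous (h : IsRealTrigSum C W v w S) : Continuous S := by
  have : S = fun x => (trigSum v w x).re := by
    funext x
    rw [← h.eq_trigSum, Complex.ofReal_re]
  rw [this]
  exact Complex.continuous_re.comp (continuous_trigSum v w)

lemma IsRealTrigSum.integral_pow (h : IsRealTrigSum C W v w S) {q : ℕ} (ι : Type) [Fintype ι]
    [DecidableEq ι] (hq : Fintype.card ι = q) :
    ((∫ x, S x ^ q ∂lebesgueUnit : ℝ) : ℂ) = moment v w ι := by
  rw [← integral_trigSum_pow, ← integral_complex_ofReal, hq]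
  simp_rw [← h.eq_trigSum]
  push_cast
  rfl

lemma exists_integral_pow_recursion (C : ℕ → ℕ) (W : ℝ) : ∃ B : ℕ → ℝ, ∀ q, 0 ≤ B q ∧
    ∀ (Z : Type) [Fintype Z] [Nonempty Z] (v : Z → ℤ) (w : Z → ℂ) (S : ℝ → ℝ),
      IsRealTrigSum C W v w S →
      |∫ x, S x ∂lebesgueUnit| ≤ B 1 ∧
      |∫ x, S x ^ 2 ∂lebesgueUnit| ≤ B 0 * Fintype.card Z ∧
      |∫ x, S x ^ (q + 2) ∂lebesgueUnit -
        (q + 1) * (∫ x, S x ^ 2 ∂lebesgueUnit) * ∫ x, S x ^ q ∂lebesgueUnit| ≤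
        B (q + 2) * √(Fintype.card Z : ℝ) ^ (q + 1) := by
  obtain ⟨K, hK⟩ := exists_moment_recursion_bound C
  obtain ⟨L, hL⟩ := exists_reps_bound C
  -- The recursion error is needed only at orders `1` and `q + 2`; index `0` is free to hold the
  -- constant of the second moment bound.
  refine ⟨fun q => if q = 0 then L 2 * |W| ^ 2 else K q * |W| ^ q, fun q => ⟨?_, ?_⟩⟩
  · dsimp only
    split_ifs
    · exact mul_nonneg (hL 2).1 (by positivity)
    · exact mul_nonneg (hK q).1 (by positivity)
  intro Z _ _ v w S h
  have hW : ∀ z, ‖w z‖ ≤ |W| := fun z => (h.norm_le z).trans (le_abs_self W)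
  refine ⟨?_, ?_, ?_⟩
  -- With one position there is no possible partner, so the recursion bounds the mean itself.
  · have h1 := (hK 1).2 Z v h.nondegBound w |W| hW (Fin 1) (Fintype.card_fin 1) 0
    have h2 := h.integral_pow (Fin 1) (Fintype.card_fin 1)
    rw [show (Finset.univ : Finset (Fin 1)).erase 0 = ∅ by decide, Finset.sum_empty, sub_zero,
      ← h2, Complex.norm_real, Real.norm_eq_abs] at h1
    simpa using h1
  · have h1 := norm_moment_le (v := v) (ι := Fin 2) hW
    have h2 := (hL 2).2 Z v h.nondegBound (Fin 2) (Fintype.card_fin 2) 0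
    rw [← h.integral_pow (Fin 2) (Fintype.card_fin 2), Complex.norm_real, Real.norm_eq_abs,
      Fintype.card_fin] at h1
    rw [Real.sq_sqrt (Nat.cast_nonneg _)] at h2
    refine h1.trans ?_
    simp only [if_true]
    calc |W| ^ 2 * ((reps v (Fin 2) 0).ncard : ℝ) ≤ |W| ^ 2 * (L 2 * Fintype.card Z) := by gcongr
      _ = _ := by ring
  · have key : ∀ (ι : Type) [Fintype ι] [DecidableEq ι] (i₀ : ι), Fintype.card ι = q + 2 →
        |∫ x, S x ^ (q + 2) ∂lebesgueUnit -
          (q + 1) * (∫ x, S x ^ 2 ∂lebesgueUnit) * ∫ x, S x ^ q ∂lebesgueUnit| ≤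
          K (q + 2) * |W| ^ (q + 2) * √(Fintype.card Z : ℝ) ^ (q + 1) := by
      intro ι _ _ i₀ hq
      have h1 := (hK (q + 2)).2 Z v h.nondegBound w |W| hW ι hq i₀
      have h2 : ∀ i ∈ (Finset.univ : Finset ι).erase i₀,
          moment v w {j // j ∈ ({i, i₀} : Finset ι)} * moment v w {j // j ∉ ({i, i₀} : Finset ι)} =
          ((∫ x, S x ^ 2 ∂lebesgueUnit : ℝ) : ℂ) * ((∫ x, S x ^ q ∂lebesgueUnit : ℝ) : ℂ) := by
        intro i hi
        have hc : ({i, i₀} : Finset ι).card = 2 :=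
          Finset.card_pair (Finset.ne_of_mem_erase hi)
        rw [h.integral_pow {j // j ∈ ({i, i₀} : Finset ι)} (by rw [Fintype.card_coe, hc]),
          h.integral_pow {j // j ∉ ({i, i₀} : Finset ι)}
          (by rw [card_subtype_notMem, hc, hq, Nat.add_sub_cancel])]
      rw [Finset.sum_congr rfl h2, Finset.sum_const, Finset.card_erase_of_mem (Finset.mem_univ _),
        Finset.card_univ, hq, ← h.integral_pow ι hq, nsmul_eq_mul,
        show q + 2 - 1 = q + 1 from rfl] at h1
      rw [← Real.norm_eq_abs, ← Complex.norm_real]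
      convert h1 using 2
      push_cast
      ring
    dsimp only
    rw [if_neg (by omega)]
    exact key (Fin (q + 2)) 0 (Fintype.card_fin _)

/-- The normalized moments obey the recursion defining `gaussMoment` up to `O(1 / √(card Z))`. Since
the normalized variance is bounded, these errors propagate by induction in steps of two. -/
lemma exists_moment_approx (C : ℕ → ℕ) (W : ℝ) : ∃ (A : ℝ) (B : ℕ → ℝ), 0 ≤ A ∧ ∀ q, 0 ≤ B q ∧
    ∀ (Z : Type) [Fintype Z] [Nonempty Z] (v : Z → ℤ) (w : Z → ℂ) (S : ℝ → ℝ),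
      IsRealTrigSum C W v w S →
      (∫ x, S x ^ 2 ∂lebesgueUnit) / Fintype.card Z ≤ A ∧
      |(∫ x, S x ^ q ∂lebesgueUnit) / √(Fintype.card Z : ℝ) ^ q -
        gaussMoment ((∫ x, S x ^ 2 ∂lebesgueUnit) / Fintype.card Z) q| ≤
        B q / √(Fintype.card Z : ℝ) := by
  obtain ⟨B, hB⟩ := exists_integral_pow_recursion C W
  have hpos : ∀ (Z : Type) [Fintype Z] [Nonempty Z], 0 < √(Fintype.card Z : ℝ) := by
    intro Z _ _
    rw [Real.sqrt_pos]
    exact_mod_cast Fintype.card_pos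
  have hA : ∀ (Z : Type) [Fintype Z] [Nonempty Z] (v : Z → ℤ) (w : Z → ℂ) (S : ℝ → ℝ),
      IsRealTrigSum C W v w S → |(∫ x, S x ^ 2 ∂lebesgueUnit) / Fintype.card Z| ≤ B 0 := by
    intro Z _ _ v w S h
    have hX : (0 : ℝ) < Fintype.card Z := by exact_mod_cast Fintype.card_pos
    rw [abs_div, abs_of_pos hX, div_le_iff₀ hX]
    exact ((hB 0).2 Z v w S h).2.1
  suffices H : ∀ q, ∃ b : ℝ, 0 ≤ b ∧ ∀ (Z : Type) [Fintype Z] [Nonempty Z] (v : Z → ℤ) (w : Z → ℂ)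
      (S : ℝ → ℝ), IsRealTrigSum C W v w S →
      |(∫ x, S x ^ q ∂lebesgueUnit) / √(Fintype.card Z : ℝ) ^ q -
        gaussMoment ((∫ x, S x ^ 2 ∂lebesgueUnit) / Fintype.card Z) q| ≤
        b / √(Fintype.card Z : ℝ) by
    choose b hb0 hb using H
    exact ⟨B 0, b, (hB 0).1, fun q => ⟨hb0 q, fun Z _ _ v w S h =>
      ⟨(le_abs_self _).trans (hA Z v w S h), hb q Z v w S h⟩⟩⟩
  intro q
  induction q using Nat.strong_induction_on with
  | _ q ih =>
    match q, ih with
    | 0, _ =>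
      refine ⟨0, le_rfl, fun Z _ _ v w S h => ?_⟩
      simp [gaussMoment]
    | 1, _ =>
      refine ⟨B 1, (hB 1).1, fun Z _ _ v w S h => ?_⟩
      have h1 := ((hB 0).2 Z v w S h).1
      simp only [pow_one, gaussMoment, sub_zero]
      rw [abs_div, abs_of_pos (hpos Z)]
      gcongr
    | q + 2, ih =>
      obtain ⟨b, hb0, hb⟩ := ih q (by omega)
      refine ⟨B (q + 2) + (q + 1) * B 0 * b, ?_, fun Z _ _ v w S h => ?_⟩
      · have := (hB (q + 2)).1
        have := (hB 0).1
        positivity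
      have h1 := ((hB q).2 Z v w S h).2.2
      have h2 := hb Z v w S h
      have h3 := hA Z v w S h
      have hr := hpos Z
      set r := √(Fintype.card Z : ℝ) with hrdef
      have hX : (Fintype.card Z : ℝ) = r ^ 2 := (Real.sq_sqrt (Nat.cast_nonneg _)).symm
      rw [gaussMoment]
      set V := (∫ x, S x ^ 2 ∂lebesgueUnit) / (Fintype.card Z : ℝ) with hV
      set M := ∫ x, S x ^ q ∂lebesgueUnit
      have hM2 : ∫ x, S x ^ 2 ∂lebesgueUnit = V * r ^ 2 := by
        rw [hV, ← hX]; field_simp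
      rw [hM2] at h1
      have e : (∫ x, S x ^ (q + 2) ∂lebesgueUnit) / r ^ (q + 2) - (q + 1) * V * gaussMoment V q =
          (∫ x, S x ^ (q + 2) ∂lebesgueUnit - (q + 1) * (V * r ^ 2) * M) / r ^ (q + 2) +
          (q + 1) * V * (M / r ^ q - gaussMoment V q) := by
        field_simp
        ring
      rw [e]
      refine (abs_add_le _ _).trans ?_
      rw [add_div]
      gcongr ?_ + ?_
      · rw [abs_div, abs_of_pos (pow_pos hr _), div_le_div_iff₀ (pow_pos hr _) hr]
        calc _ ≤ (B (q + 2) * r ^ (q + 1)) * r := by gcongr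
          _ = _ := by ring
      · rw [abs_mul, abs_mul, abs_of_pos (by positivity : (0 : ℝ) < (q : ℝ) + 1), mul_div_assoc]
        gcongr
        have := (hB 0).1
        positivity

/-- Expand the exponential to the even order `2 * P`, replace moments by Gaussian ones, and resum.
The Taylor remainder is bounded by the moment of order `2 * P`, itself close to a Gaussian moment.
-/
lemma exists_charFun_approx (C : ℕ → ℕ) (W t : ℝ) {ε : ℝ} (hε : 0 < ε) : ∃ X₀ : ℕ,
    ∀ (Z : Type) [Fintype Z] [Nonempty Z] (v : Z → ℤ) (w : Z → ℂ) (S : ℝ → ℝ),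
      IsRealTrigSum C W v w S → X₀ ≤ Fintype.card Z →
      ‖∫ x, Complex.exp ((t * (S x / √(Fintype.card Z : ℝ)) : ℝ) * Complex.I) ∂lebesgueUnit -
        Complex.exp ((-(t ^ 2 * ((∫ x, S x ^ 2 ∂lebesgueUnit) / Fintype.card Z) / 2) : ℝ))‖ ≤
          ε := by
  obtain ⟨A, B, hA0, hB⟩ := exists_moment_approx C W
  -- This quantity bounds both the Gaussian part of the Taylor remainder and the truncation error of
  -- the exponential series; `A` bounds every admissible variance, so `P` is uniform.
  obtain ⟨P, hP⟩ : ∃ P : ℕ, (t ^ 2 * A / 2) ^ P / (P.factorial : ℝ) ≤ ε / 4 := by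
    have := FloorSemiring.tendsto_pow_div_factorial_atTop (t ^ 2 * A / 2)
    exact (this.eventually_le_const (by positivity : (0 : ℝ) < ε / 4)).exists
  set D : ℝ := ∑ q ∈ Finset.range (2 * P), |t| ^ q / (q.factorial : ℝ) * B q +
    |t| ^ (2 * P) / ((2 * P).factorial : ℝ) * B (2 * P) with hD
  have hD0 : 0 ≤ D := by
    have := fun q => (hB q).1
    rw [hD]
    refine add_nonneg (Finset.sum_nonneg fun q _ => ?_) ?_
    · have := (hB q).1
      positivity
    · have := (hB (2 * P)).1
      positivity
  -- All moment errors together amount to `D / √(card Z)`; this threshold makes them at most `ε /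
  -- 2`.
  refine ⟨⌈(2 * D / ε) ^ 2⌉₊, fun Z _ _ v w S h hX => ?_⟩
  have hr : 0 < √(Fintype.card Z : ℝ) := by
    rw [Real.sqrt_pos]
    exact_mod_cast Fintype.card_pos
  have hDr : D / √(Fintype.card Z : ℝ) ≤ ε / 2 := by
    have h1 : 2 * D / ε ≤ √(Fintype.card Z : ℝ) :=
      Real.le_sqrt_of_sq_le ((Nat.le_ceil _).trans (by exact_mod_cast hX))
    rw [div_le_iff₀ hε] at h1
    rw [div_le_iff₀ hr]
    linarith
  set r := √(Fintype.card Z : ℝ) with hrdef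
  have hVA := ((hB 0).2 Z v w S h).1
  have hV0 : 0 ≤ (∫ x, S x ^ 2 ∂lebesgueUnit) / (Fintype.card Z : ℝ) :=
    div_nonneg (integral_nonneg fun x => sq_nonneg _) (Nat.cast_nonneg _)
  have hm := fun q => ((hB q).2 Z v w S h).2
  set V := (∫ x, S x ^ 2 ∂lebesgueUnit) / (Fintype.card Z : ℝ) with hV
  have hc := h.continuous
  set m : ℕ → ℝ := fun q => (∫ x, S x ^ q ∂lebesgueUnit) / r ^ q with hmdef
  have hterm : ∀ q, ∫ x, (((t * (S x / r) : ℝ) : ℂ) * Complex.I) ^ q / (q.factorial : ℂ)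
      ∂lebesgueUnit = (t * Complex.I) ^ q / (q.factorial : ℂ) * (m q : ℂ) := by
    intro q
    have : ∀ x, (((t * (S x / r) : ℝ) : ℂ) * Complex.I) ^ q / (q.factorial : ℂ) =
        ((t * Complex.I) ^ q / (q.factorial : ℂ) / (r : ℂ) ^ q) * ((S x ^ q : ℝ) : ℂ) := by
      intro x
      push_cast
      rw [show (t : ℂ) * (S x / r) * Complex.I = (t * Complex.I) * S x / r by ring, div_pow,
        mul_pow]
      ring
    simp_rw [this]
    rw [integral_const_mul, integral_complex_ofReal, hmdef]
    push_cast
    ring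
  have hT : ‖∫ x, Complex.exp ((t * (S x / r) : ℝ) * Complex.I) ∂lebesgueUnit -
      ∑ q ∈ Finset.range (2 * P), (t * Complex.I) ^ q / (q.factorial : ℂ) * (m q : ℂ)‖ ≤
      |t| ^ (2 * P) / ((2 * P).factorial : ℝ) * m (2 * P) := by
    rw [← Finset.sum_congr rfl fun q _ => hterm q,
      ← integral_finsetSum _ fun q _ => integrable_of_continuous (by fun_prop),
      ← integral_sub (integrable_of_continuous (by fun_prop))
        (integrable_of_continuous (by fun_prop))]
    have hI : |t| ^ (2 * P) / ((2 * P).factorial : ℝ) * m (2 * P) =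
        ∫ x, |t| ^ (2 * P) / ((2 * P).factorial : ℝ) / r ^ (2 * P) * S x ^ (2 * P)
          ∂lebesgueUnit := by
      rw [integral_const_mul, hmdef]
      ring
    rw [hI]
    refine norm_integral_le_of_norm_le (integrable_of_continuous (by fun_prop)) ?_
    refine Eventually.of_forall fun x => ?_
    refine (norm_exp_sub_sum_le (by simp) (2 * P)).trans (le_of_eq ?_)
    rw [norm_mul, Complex.norm_I, mul_one, Complex.norm_real, Real.norm_eq_abs, pow_mul, pow_mul,
      sq_abs, sq_abs, pow_mul, pow_mul]
    rw [mul_pow, div_pow, mul_pow, div_pow]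
    ring
  have hG : ‖∑ q ∈ Finset.range (2 * P), (t * Complex.I) ^ q / (q.factorial : ℂ) * (m q : ℂ) -
      ∑ q ∈ Finset.range (2 * P), (t * Complex.I) ^ q / (q.factorial : ℂ) *
        (gaussMoment V q : ℂ)‖ ≤
      ∑ q ∈ Finset.range (2 * P), |t| ^ q / (q.factorial : ℝ) * (B q / r) := by
    rw [← Finset.sum_sub_distrib]
    refine norm_sum_le_of_le _ fun q _ => ?_
    rw [← mul_sub, norm_mul, norm_div, norm_pow, norm_mul, Complex.norm_I, mul_one,
      Complex.norm_real, Real.norm_eq_abs, ← Complex.ofReal_sub, Complex.norm_real,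
      Real.norm_eq_abs, RCLike.norm_natCast]
    gcongr
    exact hm q
  have hm2 : m (2 * P) ≤ gaussMoment V (2 * P) + B (2 * P) / r := by
    have := (abs_le.1 (hm (2 * P))).2
    linarith
  have htail : |t| ^ (2 * P) / ((2 * P).factorial : ℝ) * gaussMoment V (2 * P) ≤ ε / 4 := by
    refine le_trans ?_ hP
    calc |t| ^ (2 * P) / ((2 * P).factorial : ℝ) * gaussMoment V (2 * P)
        = |t| ^ (2 * P) * (gaussMoment V (2 * P) / ((2 * P).factorial : ℝ)) := by ring
      _ = (t ^ 2 * V / 2) ^ P / (P.factorial : ℝ) := by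
        rw [gaussMoment_even, pow_mul, sq_abs, mul_div_assoc, mul_pow]
        ring
      _ ≤ _ := by gcongr
  have hE : ‖∑ q ∈ Finset.range (2 * P), (t * Complex.I) ^ q / (q.factorial : ℂ) *
        (gaussMoment V q : ℂ) - Complex.exp ((-(t ^ 2 * V / 2) : ℝ))‖ ≤ ε / 4 := by
    rw [sum_gaussMoment, norm_sub_rev]
    have hy : 0 ≤ t ^ 2 * V / 2 := by positivity
    refine (norm_exp_sub_sum_le (by rw [Complex.ofReal_re]; linarith) P).trans ?_
    rw [Complex.norm_real, Real.norm_eq_abs, abs_neg, abs_of_nonneg hy]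
    refine le_trans ?_ hP
    gcongr
  have hsum : ∑ q ∈ Finset.range (2 * P), |t| ^ q / (q.factorial : ℝ) * (B q / r) +
      |t| ^ (2 * P) / ((2 * P).factorial : ℝ) * (B (2 * P) / r) = D / r := by
    rw [hD, add_div, Finset.sum_div]
    congr 1
    · exact Finset.sum_congr rfl fun q _ => by ring
    · ring
  have hT2 : |t| ^ (2 * P) / ((2 * P).factorial : ℝ) * m (2 * P) ≤
      ε / 4 + |t| ^ (2 * P) / ((2 * P).factorial : ℝ) * (B (2 * P) / r) := by
    calc _ ≤ |t| ^ (2 * P) / ((2 * P).factorial : ℝ) *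
          (gaussMoment V (2 * P) + B (2 * P) / r) := by gcongr
      _ ≤ _ := by rw [mul_add]; gcongr
  have htri : ∀ a b c d : ℂ, ‖a - d‖ ≤ ‖a - b‖ + ‖b - c‖ + ‖c - d‖ := by
    intro a b c d
    calc ‖a - d‖ = ‖(a - b) + (b - c) + (c - d)‖ := by congr 1; ring
      _ ≤ _ := norm_add₃_le
  refine (htri _ _ _ _).trans ((add_le_add (add_le_add hT hG) hE).trans ?_)
  linarith

end CharFun

/-! ### Coincidences `j * n k = j' * n k'` and the mean square of Fourier tails -/

section GcdSums

/-- List the elements by increasing `h`. The counting hypothesis at `A = h t` forces `(i + 1) ^ 2 ≤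
M * h t` for the element `t` in place `i`, counted from `0`. -/
lemma sum_inv_le_sum_min {α : Type} (h : α → ℕ) {M a : ℝ} (ha : 0 < a)
    (T : Finset α) (hT : ∀ t ∈ T, a ≤ h t)
    (hcard : ∀ A : ℕ, ((T.filter fun t => h t ≤ A).card : ℝ) ^ 2 ≤ M * A) :
    ∑ t ∈ T, (h t : ℝ)⁻¹ ≤
      ∑ i ∈ Finset.range T.card, min a⁻¹ (M * (((i + 1 : ℕ) : ℝ) ^ 2)⁻¹) := by
  classical
  induction T using Finset.induction_on_max_value h with
  | empty => simp
  | insert t s hts hmax ih =>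
    rw [Finset.sum_insert hts, Finset.card_insert_of_notMem hts, Finset.sum_range_succ, add_comm]
    refine add_le_add (ih (fun x hx => hT x (Finset.mem_insert_of_mem hx)) fun A => ?_) ?_
    · refine le_trans ?_ (hcard A)
      gcongr
      exact Finset.subset_insert _ _
    · have hat := hT t (Finset.mem_insert_self _ _)
      have ht : (0 : ℝ) < h t := ha.trans_le hat
      refine le_min (inv_anti₀ ha hat) ?_
      have h1 := hcard (h t)
      have h2 : (insert t s).filter (fun x => h x ≤ h t) = insert t s := by
        refine Finset.filter_true_of_mem fun x hx => ?_
        rcases Finset.mem_insert.1 hx with rfl | hx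
        · exact le_rfl
        · exact hmax x hx
      rw [h2, Finset.card_insert_of_notMem hts] at h1
      have h3 : (0 : ℝ) < ((s.card + 1 : ℕ) : ℝ) ^ 2 := by positivity
      rw [← div_eq_mul_inv, inv_eq_one_div, div_le_div_iff₀ ht h3, one_mul]
      exact h1

lemma min_le_rpow {x y : ℝ} (hx : 0 ≤ x) (hy : 0 ≤ y) :
    min x y ≤ x ^ (1 / 4 : ℝ) * y ^ (3 / 4 : ℝ) := by
  have hm : 0 ≤ min x y := le_min hx hy
  calc min x y = min x y ^ (1 / 4 : ℝ) * min x y ^ (3 / 4 : ℝ) := by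
        rw [← Real.rpow_add' hm (by norm_num)]; norm_num
    _ ≤ _ := by
        gcongr
        · exact min_le_left _ _
        · exact min_le_right _ _

/-- Interpolating the two bounds with weights `1 / 4` and `3 / 4` keeps a negative power of `a` and
leaves the summable series of `(i + 1) ^ (-3 / 2)`. -/
lemma exists_sum_inv_bound (M : ℝ) (hM : 0 ≤ M) : ∃ B : ℝ, 0 ≤ B ∧
    ∀ {α : Type} (h : α → ℕ) (a : ℝ), 0 < a → ∀ T : Finset α, (∀ t ∈ T, a ≤ h t) →
      (∀ A : ℕ, ((T.filter fun t => h t ≤ A).card : ℝ) ^ 2 ≤ M * A) →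
      ∑ t ∈ T, (h t : ℝ)⁻¹ ≤ B * a ^ (-(1 / 4) : ℝ) := by
  have hs : Summable fun i : ℕ => ((i + 1 : ℕ) : ℝ) ^ (-(3 / 2) : ℝ) :=
    (summable_nat_add_iff 1).2 (Real.summable_nat_rpow.2 (by norm_num))
  refine ⟨M ^ (3 / 4 : ℝ) * ∑' i : ℕ, ((i + 1 : ℕ) : ℝ) ^ (-(3 / 2) : ℝ), ?_, ?_⟩
  · exact mul_nonneg (by positivity) (tsum_nonneg fun i => by positivity)
  intro α h a ha T hT hcard
  refine (sum_inv_le_sum_min h ha T hT hcard).trans ?_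
  have h1 : ∀ i ∈ Finset.range T.card, min a⁻¹ (M * (((i + 1 : ℕ) : ℝ) ^ 2)⁻¹) ≤
      a ^ (-(1 / 4) : ℝ) * M ^ (3 / 4 : ℝ) * ((i + 1 : ℕ) : ℝ) ^ (-(3 / 2) : ℝ) := by
    intro i _
    refine (min_le_rpow (by positivity) (by positivity)).trans (le_of_eq ?_)
    rw [Real.mul_rpow hM (by positivity), Real.inv_rpow ha.le, ← Real.rpow_neg ha.le,
      ← Real.rpow_natCast, ← Real.rpow_neg (by positivity), ← Real.rpow_mul (by positivity)]
    norm_num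
    ring
  refine (Finset.sum_le_sum h1).trans ?_
  rw [← Finset.mul_sum]
  have h2 := hs.sum_le_tsum (Finset.range T.card) fun i _ => by positivity
  calc _ ≤ a ^ (-(1 / 4) : ℝ) * M ^ (3 / 4 : ℝ) *
        ∑' i : ℕ, ((i + 1 : ℕ) : ℝ) ^ (-(3 / 2) : ℝ) := by gcongr
    _ = _ := by ring

/-- Adding the equations of two members `p`, `q` shows that `|p.1 + q.1|` determines `n p.2 + n
q.2`. There are at most `2 * A + 1` values of the former, and `A_2` with both coefficients `1`
bounds the number of index pairs with a given positive sum. This bounds the square of the count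
linearly in `A`. -/
lemma exists_card_ratio_bound {n : ℕ → ℕ} (hpos : ∀ k, 0 < n k) (hA : ConditionA n 2) :
    ∃ C : ℕ, ∀ (D : Finset ℤ) (F : Finset ℕ) (j : ℤ) (l A : ℕ), (∀ j ∈ D, j ≠ 0) → j ≠ 0 →
      ((D ×ˢ F).filter fun p => j * n p.2 = p.1 * n l ∧ p.1.natAbs ≤ A).card ^ 2 ≤ C * A := by
  classical
  obtain ⟨C, _, hC⟩ := hA
  refine ⟨3 * C, fun D F j l A hD hj => ?_⟩
  set T := (D ×ˢ F).filter fun p => j * n p.2 = p.1 * n l ∧ p.1.natAbs ≤ A with hT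
  have hTm : ∀ p ∈ T, p.1 ≠ 0 ∧ j * n p.2 = p.1 * n l ∧ p.1.natAbs ≤ A := by
    intro p hp
    obtain ⟨h1, h2⟩ := Finset.mem_filter.1 hp
    exact ⟨hD _ (Finset.mem_product.1 h1).1, h2⟩
  -- The later estimate `2 * A + 1 ≤ 3 * A` needs `A` positive; for `A = 0` no nonzero frequency
  -- qualifies.
  rcases Nat.eq_zero_or_pos A with rfl | hApos
  · have : T = ∅ := by
      refine Finset.eq_empty_of_forall_notMem fun p hp => ?_
      obtain ⟨h1, _, h2⟩ := hTm p hp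
      exact h1 (by omega)
    simp [this]
  have hl : (n l : ℤ) ≠ 0 := by exact_mod_cast (hpos l).ne'
  have h := Finset.card_le_mul_card_image (f := fun pq : (ℤ × ℕ) × (ℤ × ℕ) => (pq.1.1 + pq.2.1).natAbs)
    (T ×ˢ T) C ?_
  · rw [Finset.card_product, ← sq] at h
    refine h.trans ?_
    have himg : (T ×ˢ T).image (fun pq : (ℤ × ℕ) × (ℤ × ℕ) => (pq.1.1 + pq.2.1).natAbs) ⊆
        Finset.range (2 * A + 1) := by
      intro s hs
      obtain ⟨⟨p, q⟩, hpq, rfl⟩ := Finset.mem_image.1 hs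
      obtain ⟨hp, hq⟩ := Finset.mem_product.1 hpq
      have h1 := (hTm p hp).2.2
      have h2 := (hTm q hq).2.2
      rw [Finset.mem_range]
      dsimp only
      omega
    have := Finset.card_le_card himg
    rw [Finset.card_range] at this
    calc _ ≤ C * (2 * A + 1) := by gcongr
      _ ≤ C * (3 * A) := by gcongr; omega
      _ = _ := by ring
  · intro s hs
    obtain ⟨⟨p₀, q₀⟩, hpq, rfl⟩ := Finset.mem_image.1 hs
    obtain ⟨hp₀, hq₀⟩ := Finset.mem_product.1 hpq
    set b : ℤ := (n p₀.2 : ℤ) + n q₀.2 with hb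
    have hb0 : b ≠ 0 := by
      have := hpos p₀.2
      have := hpos q₀.2
      omega
    have hsol := hC b hb0 (fun _ => 1) (fun _ => one_ne_zero)
    have hfin := Set.finite_of_encard_le_coe hsol
    rw [← hfin.cast_ncard_eq, Nat.cast_le] at hsol
    refine le_trans ?_ hsol
    rw [← Set.ncard_coe_finset]
    have key : ∀ p q : ℤ × ℕ, p ∈ T → q ∈ T →
        j.natAbs * (n p.2 + n q.2) = (p.1 + q.1).natAbs * n l := by
      intro p q hp hq
      have h1 := (hTm p hp).2.1
      have h2 := (hTm q hq).2.1
      have h3 : j * ((n p.2 + n q.2 : ℕ) : ℤ) = (p.1 + q.1) * n l := by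
        push_cast; linarith
      have := congrArg Int.natAbs h3
      rwa [Int.natAbs_mul, Int.natAbs_mul, Int.natAbs_natCast, Int.natAbs_natCast] at this
    refine Set.ncard_le_ncard_of_injOn (fun pq => ![pq.1.2, pq.2.2]) ?_ ?_ hfin
    · rintro ⟨p, q⟩ hx
      simp only [Finset.coe_filter, Finset.mem_product, Set.mem_ofPred_eq] at hx
      obtain ⟨⟨hp, hq⟩, hs⟩ := hx
      have e1 := key p q hp hq
      rw [hs, ← key p₀ q₀ hp₀ hq₀] at e1
      have e2 : n p.2 + n q.2 = n p₀.2 + n q₀.2 :=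
        Nat.eq_of_mul_eq_mul_left (Int.natAbs_pos.2 hj) e1
      refine ⟨?_, fun u hu => ?_⟩
      · simp only [Fin.sum_univ_two, Matrix.cons_val_zero, Matrix.cons_val_one, one_mul]
        rw [hb]
        exact_mod_cast e2
      · refine (Finset.sum_pos (fun i _ => ?_) hu).ne'
        rw [one_mul]
        exact_mod_cast hpos _
    · rintro ⟨p, q⟩ hx ⟨p', q'⟩ hx' hxx
      simp only [Finset.coe_filter, Finset.mem_product, Set.mem_ofPred_eq] at hx hx'
      have hinj : ∀ p p' : ℤ × ℕ, p ∈ T → p' ∈ T → p.2 = p'.2 → p = p' := by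
        intro p p' hp hp' h
        have h1 := (hTm p hp).2.1
        have h2 := (hTm p' hp').2.1
        rw [h, h2] at h1
        exact Prod.ext (mul_right_cancel₀ hl h1.symm) h
      have e0 : p.2 = p'.2 := congrFun hxx 0
      have e1 : q.2 = q'.2 := congrFun hxx 1
      rw [hinj p p' hx.1.1 hx'.1.1 e0, hinj q q' hx.1.2 hx'.1.2 e1]

/-- The extra decay `|j| ^ (-1 / 4)` makes the sum over frequencies convergent, so that
high-frequency blocks contribute little. By symmetry it suffices to treat `|p.1| ≤ |p'.1|`. -/
lemma exists_gcd_sum_bound {n : ℕ → ℕ} (hpos : ∀ k, 0 < n k) (hA : ConditionA n 2) :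
    ∃ B : ℝ, 0 ≤ B ∧ ∀ (D : Finset ℤ) (F : Finset ℕ), (∀ j ∈ D, j ≠ 0) →
      ∑ p ∈ D ×ˢ F, ∑ p' ∈ D ×ˢ F, (if p.1 * n p.2 = p'.1 * n p'.2 then
        ((p.1.natAbs : ℝ))⁻¹ * ((p'.1.natAbs : ℝ))⁻¹ else 0) ≤
      B * F.card * ∑ j ∈ D, |(j : ℝ)| ^ (-(5 / 4) : ℝ) := by
  classical
  obtain ⟨C, hC⟩ := exists_card_ratio_bound hpos hA
  obtain ⟨B, hB0, hB⟩ := exists_sum_inv_bound C (Nat.cast_nonneg _)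
  refine ⟨2 * B, by positivity, fun D F hD => ?_⟩
  set g : ℤ × ℕ → ℤ × ℕ → ℝ := fun p p' => if p.1 * n p.2 = p'.1 * n p'.2 ∧
    p.1.natAbs ≤ p'.1.natAbs then ((p.1.natAbs : ℝ))⁻¹ * ((p'.1.natAbs : ℝ))⁻¹ else 0 with hg
  have h1 : ∀ p p' : ℤ × ℕ, (if p.1 * n p.2 = p'.1 * n p'.2 then
        ((p.1.natAbs : ℝ))⁻¹ * ((p'.1.natAbs : ℝ))⁻¹ else 0) ≤ g p p' + g p' p := by
    intro p p'
    have e : (p'.1 * (n p'.2 : ℤ) = p.1 * n p.2) ↔ (p.1 * (n p.2 : ℤ) = p'.1 * n p'.2) := eq_comm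
    have h0 : 0 ≤ ((p.1.natAbs : ℝ))⁻¹ * ((p'.1.natAbs : ℝ))⁻¹ := by positivity
    simp only [hg, e]
    rw [mul_comm ((p'.1.natAbs : ℝ))⁻¹]
    by_cases heq : p.1 * (n p.2 : ℤ) = p'.1 * n p'.2
    · simp only [heq, true_and, if_true]
      rcases le_total p.1.natAbs p'.1.natAbs with h | h
      · rw [if_pos h]
        have : 0 ≤ if p'.1.natAbs ≤ p.1.natAbs then
          ((p.1.natAbs : ℝ))⁻¹ * ((p'.1.natAbs : ℝ))⁻¹ else 0 := by split_ifs <;> positivity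
        linarith
      · rw [if_pos h]
        have : 0 ≤ if p.1.natAbs ≤ p'.1.natAbs then
          ((p.1.natAbs : ℝ))⁻¹ * ((p'.1.natAbs : ℝ))⁻¹ else 0 := by split_ifs <;> positivity
        linarith
    · simp [heq]
  have h2 : ∑ p ∈ D ×ˢ F, ∑ p' ∈ D ×ˢ F, g p p' ≤
      B * F.card * ∑ j ∈ D, |(j : ℝ)| ^ (-(5 / 4) : ℝ) := by
    -- Regroup by the smaller frequency `j` and the index `l` attached to the larger one. The inner
    -- sum over the larger frequency and the other index is the one controlled by
    -- `exists_card_ratio_bound`.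
    have h3 : ∑ p ∈ D ×ˢ F, ∑ p' ∈ D ×ˢ F, g p p' =
        ∑ l ∈ F, ∑ j ∈ D, ∑ q ∈ D ×ˢ F, g (j, q.2) (q.1, l) := by
      simp_rw [Finset.sum_product]
      rw [Finset.sum_comm (s := F) (t := D)]
      refine Finset.sum_congr rfl fun j _ => ?_
      rw [Finset.sum_comm]
      exact (Finset.sum_congr rfl fun j' _ => Finset.sum_comm).trans Finset.sum_comm
    have h4 : ∀ l ∈ F, ∀ j ∈ D, ∑ q ∈ D ×ˢ F, g (j, q.2) (q.1, l) ≤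
        B * |(j : ℝ)| ^ (-(5 / 4) : ℝ) := by
      intro l _ j hj
      have hj0 : (0 : ℝ) < j.natAbs := by exact_mod_cast Int.natAbs_pos.2 (hD j hj)
      have h5 := hB (fun q : ℤ × ℕ => q.1.natAbs) (j.natAbs : ℝ) hj0 ((D ×ˢ F).filter
        fun q => j * n q.2 = q.1 * n l ∧ j.natAbs ≤ q.1.natAbs)
        (fun q hq => by exact_mod_cast (Finset.mem_filter.1 hq).2.2) (fun A => by
          refine le_trans ?_ (by exact_mod_cast hC D F j l A hD (hD j hj) :
            ((((D ×ˢ F).filter fun p => j * n p.2 = p.1 * n l ∧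
              p.1.natAbs ≤ A).card : ℕ) : ℝ) ^ 2 ≤ C * A)
          gcongr
          intro q hq
          simp only [Finset.mem_filter] at hq ⊢
          exact ⟨hq.1.1, hq.1.2.1, hq.2⟩)
      have h6 : ∑ q ∈ D ×ˢ F, g (j, q.2) (q.1, l) = ((j.natAbs : ℝ))⁻¹ *
          ∑ q ∈ (D ×ˢ F).filter fun q => j * n q.2 = q.1 * n l ∧ j.natAbs ≤ q.1.natAbs,
            ((q.1.natAbs : ℝ))⁻¹ := by
        rw [Finset.mul_sum, Finset.sum_filter]
      rw [h6]
      have hjabs : |(j : ℝ)| = (j.natAbs : ℝ) := by rw [Nat.cast_natAbs, Int.cast_abs]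
      calc _ ≤ ((j.natAbs : ℝ))⁻¹ * (B * (j.natAbs : ℝ) ^ (-(1 / 4) : ℝ)) := by gcongr
        _ = B * ((j.natAbs : ℝ) ^ (-1 : ℝ) * (j.natAbs : ℝ) ^ (-(1 / 4) : ℝ)) := by
          rw [Real.rpow_neg_one]; ring
        _ = _ := by
          rw [← Real.rpow_add hj0, hjabs]; norm_num
    rw [h3]
    refine (Finset.sum_le_sum fun l hl => Finset.sum_le_sum fun j hj => h4 l hl j hj).trans
      (le_of_eq ?_)
    rw [Finset.sum_const, nsmul_eq_mul, ← Finset.mul_sum]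
    ring
  calc _ ≤ ∑ p ∈ D ×ˢ F, ∑ p' ∈ D ×ˢ F, (g p p' + g p' p) :=
        Finset.sum_le_sum fun p _ => Finset.sum_le_sum fun p' _ => h1 p p'
    _ = 2 * ∑ p ∈ D ×ˢ F, ∑ p' ∈ D ×ˢ F, g p p' := by
      simp_rw [Finset.sum_add_distrib]
      rw [Finset.sum_comm (f := fun p p' => g p' p)]
      ring
    _ ≤ _ := by linarith

lemma integral_norm_sq_block_le (n : ℕ → ℕ) {c : ℤ → ℂ} {K : ℝ} {D : Finset ℤ}
    (hc : ∀ j ∈ D, ‖c j‖ ≤ K * |(j : ℝ)|⁻¹) (F : Finset ℕ) :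
    ∫ x, ‖∑ k ∈ F, ∑ j ∈ D, c j * trigChar j (n k * x)‖ ^ 2 ∂lebesgueUnit ≤
      ∑ p ∈ D ×ˢ F, ∑ p' ∈ D ×ˢ F, K ^ 2 * (if p.1 * n p.2 = p'.1 * n p'.2 then
        ((p.1.natAbs : ℝ))⁻¹ * ((p'.1.natAbs : ℝ))⁻¹ else 0) := by
  classical
  have h1 : ∀ x, ∑ k ∈ F, ∑ j ∈ D, c j * trigChar j (n k * x) =
      trigSum (letterVal n D F) (fun z => c z.1.1) x := by
    intro x
    unfold trigSum letterVal
    rw [Finset.sum_coe_sort (D ×ˢ F) (fun p => c p.1 * trigChar (p.1 * n p.2) x),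
      Finset.sum_product_right]
    simp_rw [trigChar_mul_nat]
  simp_rw [h1]
  have h2 := integral_norm_trigSum_sq (letterVal n D F) (fun z => c z.1.1)
  rw [integral_complex_ofReal] at h2
  have h3 := Complex.norm_real
    (∫ x, ‖trigSum (letterVal n D F) (fun z => c z.1.1) x‖ ^ 2 ∂lebesgueUnit)
  refine (le_abs_self _).trans ?_
  rw [← Real.norm_eq_abs, ← h3, h2, ← Finset.sum_coe_sort (D ×ˢ F)]
  refine norm_sum_le_of_le _ fun z _ => ?_
  rw [← Finset.sum_coe_sort (D ×ˢ F)]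
  refine norm_sum_le_of_le _ fun z' _ => ?_
  unfold letterVal
  split_ifs with h
  · rw [norm_mul, RCLike.norm_conj]
    have e1 := hc z.1.1 (Finset.mem_product.1 z.2).1
    have e2 := hc z'.1.1 (Finset.mem_product.1 z'.2).1
    have hjabs : ∀ j : ℤ, |(j : ℝ)| = (j.natAbs : ℝ) := fun j => by
      rw [Nat.cast_natAbs, Int.cast_abs]
    rw [hjabs] at e1 e2
    calc _ ≤ (K * ((z.1.1.natAbs : ℝ))⁻¹) * (K * ((z'.1.1.natAbs : ℝ))⁻¹) :=
          mul_le_mul e1 e2 (norm_nonneg _) ((norm_nonneg _).trans e1)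
      _ = _ := by ring
  · simp

/-- Blocks of Fourier series with coefficients `O(1 / j)` and high frequencies contribute little
to the mean square of sums along a sequence satisfying condition `A_2`. -/
lemma exists_integral_norm_sq_tail_le {n : ℕ → ℕ} (hpos : ∀ k, 0 < n k) (hA : ConditionA n 2)
    {c : ℤ → ℂ} {K : ℝ} (hc : ∀ j ≠ 0, ‖c j‖ ≤ K * |(j : ℝ)|⁻¹) {ε : ℝ} (hε : 0 < ε) :
    ∃ J₀ : ℕ, ∀ J L : ℕ, J₀ ≤ J → ∀ F : Finset ℕ,
      ∫ x, ‖∑ k ∈ F, ∑ j ∈ freqs L \ freqs J, c j * trigChar j (n k * x)‖ ^ 2 ∂lebesgueUnit ≤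
        ε * F.card := by
  classical
  obtain ⟨B, hB0, hB⟩ := exists_gcd_sum_bound hpos hA
  have hs : Summable fun j : ℤ => |(j : ℝ)| ^ (-(5 / 4) : ℝ) :=
    Real.summable_abs_int_rpow (by norm_num)
  have hKB : 0 < K ^ 2 * B + 1 := by positivity
  -- The summand `1` only keeps the denominator positive.
  obtain ⟨δ, hδ⟩ : ∃ δ, δ = ε / (K ^ 2 * B + 1) := ⟨_, rfl⟩
  have hδ0 : 0 < δ := by rw [hδ]; positivity
  obtain ⟨s, hs⟩ := summable_iff_vanishing_norm.1 hs δ hδ0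
  refine ⟨s.sup Int.natAbs, fun J L hJ F => ?_⟩
  have hD : ∀ j ∈ freqs L \ freqs J, j ≠ 0 :=
    fun j hj => ne_zero_of_mem_freqs (Finset.mem_sdiff.1 hj).1
  have hdisj : Disjoint (freqs L \ freqs J) s := by
    rw [Finset.disjoint_right]
    intro j hj hjD
    have h1 : j.natAbs ≤ J := (Finset.le_sup (f := Int.natAbs) hj).trans hJ
    refine (Finset.mem_sdiff.1 hjD).2 ?_
    refine Finset.mem_erase.2 ⟨hD j hjD, Finset.mem_Icc.2 ⟨by omega, by omega⟩⟩
  have htail := hs _ hdisj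
  rw [Real.norm_eq_abs, abs_of_nonneg (Finset.sum_nonneg fun j _ => by positivity)] at htail
  refine (integral_norm_sq_block_le n (fun j hj => hc j (hD j hj)) F).trans ?_
  simp_rw [← Finset.mul_sum]
  have h6 : (K ^ 2 * B + 1) * δ = ε := by rw [hδ]; field_simp
  have h7 := mul_le_mul_of_nonneg_left (hB _ F hD) (sq_nonneg K)
  have h8 := mul_le_mul_of_nonneg_left htail.le (by positivity : 0 ≤ B * (F.card : ℝ))
  have h9 := mul_le_mul_of_nonneg_left h8 (sq_nonneg K)
  have h10 : (0 : ℝ) ≤ δ * F.card := by positivity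
  refine (h7.trans h9).trans ?_
  rw [← h6]
  linarith

end GcdSums

/-! ### Bounded measurable functions -/

section BddMeas

variable {𝕜 : Type} [RCLike 𝕜]

/-- Bounded measurable functions on the line. -/
def BddMeas (g : ℝ → 𝕜) : Prop := Measurable g ∧ ∃ M : ℝ, ∀ x, ‖g x‖ ≤ M

variable {g h : ℝ → 𝕜}

lemma BddMeas.integrable (hg : BddMeas g) : Integrable g lebesgueUnit := by
  obtain ⟨hm, M, hM⟩ := hg
  exact Integrable.of_bound hm.aestronglyMeasurable M (Eventually.of_forall hM)

lemma BddMeas.intervalIntegrable (hg : BddMeas g) (a b : ℝ) : IntervalIntegrable g volume a b := by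
  obtain ⟨hm, M, hM⟩ := hg
  rw [intervalIntegrable_iff]
  exact IntegrableOn.of_bound (by simp) hm.aestronglyMeasurable M
    (Eventually.of_forall hM)

lemma BddMeas.add (hg : BddMeas g) (hh : BddMeas h) : BddMeas fun x => g x + h x := by
  obtain ⟨hm, M, hM⟩ := hg
  obtain ⟨hm', M', hM'⟩ := hh
  exact ⟨hm.add hm', M + M', fun x => (norm_add_le _ _).trans (add_le_add (hM x) (hM' x))⟩

lemma BddMeas.sub (hg : BddMeas g) (hh : BddMeas h) : BddMeas fun x => g x - h x := by
  obtain ⟨hm, M, hM⟩ := hg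
  obtain ⟨hm', M', hM'⟩ := hh
  exact ⟨hm.sub hm', M + M', fun x => (norm_sub_le _ _).trans (add_le_add (hM x) (hM' x))⟩

lemma BddMeas.mul (hg : BddMeas g) (hh : BddMeas h) : BddMeas fun x => g x * h x := by
  obtain ⟨hm, M, hM⟩ := hg
  obtain ⟨hm', M', hM'⟩ := hh
  refine ⟨hm.mul hm', M * M', fun x => ?_⟩
  rw [norm_mul]
  exact mul_le_mul (hM x) (hM' x) (norm_nonneg _) ((norm_nonneg _).trans (hM x))

lemma bddMeas_const (c : 𝕜) : BddMeas fun _ => c := ⟨measurable_const, ‖c‖, fun _ => le_rfl⟩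

lemma BddMeas.pow (hg : BddMeas g) (q : ℕ) : BddMeas fun x => g x ^ q := by
  induction q with
  | zero => simpa using bddMeas_const (1 : 𝕜)
  | succ q ih => simpa [pow_succ] using ih.mul hg

lemma BddMeas.sum {ι : Type} {s : Finset ι} {g : ι → ℝ → 𝕜} (hg : ∀ i ∈ s, BddMeas (g i)) :
    BddMeas fun x => ∑ i ∈ s, g i x := by
  classical
  induction s using Finset.induction_on with
  | empty => simpa using bddMeas_const (0 : 𝕜)
  | insert a s ha ih =>
    simp_rw [Finset.sum_insert ha]
    exact (hg a (Finset.mem_insert_self _ _)).add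
      (ih fun i hi => hg i (Finset.mem_insert_of_mem hi))

lemma BddMeas.norm (hg : BddMeas g) : BddMeas fun x => ‖g x‖ := by
  obtain ⟨hm, M, hM⟩ := hg
  exact ⟨hm.norm, M, fun x => by simpa using hM x⟩

lemma BddMeas.ofReal {g : ℝ → ℝ} (hg : BddMeas g) : BddMeas fun x => (g x : ℂ) := by
  obtain ⟨hm, M, hM⟩ := hg
  exact ⟨Complex.measurable_ofReal.comp hm, M, fun x => by simpa using hM x⟩

lemma BddMeas.comp_mul (hg : BddMeas g) (a : ℝ) : BddMeas fun x => g (a * x) := by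
  obtain ⟨hm, M, hM⟩ := hg
  exact ⟨hm.comp (measurable_const_mul a), M, fun x => hM _⟩

lemma bddMeas_trigChar (m : ℤ) : BddMeas (trigChar m) :=
  ⟨(continuous_trigChar m).measurable, 1, fun x => (norm_trigChar m x).le⟩

/-- Dilation by a positive integer preserves the mean of a function of period one. -/
lemma integral_comp_nat_mul {g : ℝ → ℝ} (hg : BddMeas g) (hper : ∀ x, g (x + 1) = g x)
    {m : ℕ} (hm : 0 < m) : ∫ x, g (m * x) ∂lebesgueUnit = ∫ x, g x ∂lebesgueUnit := by
  rw [integral_lebesgueUnit, integral_lebesgueUnit]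
  have hm' : (m : ℝ) ≠ 0 := by exact_mod_cast hm.ne'
  rw [intervalIntegral.integral_comp_mul_left g hm', mul_zero, mul_one]
  have h := Function.Periodic.intervalIntegral_add_zsmul_eq (f := g) (T := 1) hper m 0
    (fun a b => hg.intervalIntegrable a b)
  simp only [zsmul_eq_mul, Int.cast_natCast, mul_one, zero_add] at h
  rw [h, smul_eq_mul, ← mul_assoc, inv_mul_cancel₀ hm', one_mul]

end BddMeas

/-! ### Fourier coefficients and truncation of functions of bounded variation -/

section FourierCoefficients

/-- The Fourier coefficients of a function of period one. -/
noncomputable def fcoef (f : ℝ → ℝ) (j : ℤ) : ℂ := ∫ x, (f x : ℂ) * trigChar (-j) x ∂lebesgueUnit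

/-- The partial sums of the Fourier series, without the constant term. -/
noncomputable def fpartial (f : ℝ → ℝ) (J : ℕ) (x : ℝ) : ℂ :=
  ∑ j ∈ freqs J, fcoef f j * trigChar j x

lemma star_fcoef (f : ℝ → ℝ) (j : ℤ) : (starRingEnd ℂ) (fcoef f j) = fcoef f (-j) := by
  unfold fcoef
  rw [← integral_conj]
  simp_rw [map_mul, star_trigChar, Complex.conj_ofReal]

lemma neg_mem_freqs {J : ℕ} {j : ℤ} (h : j ∈ freqs J) : -j ∈ freqs J := by
  unfold freqs at *
  rw [Finset.mem_erase, Finset.mem_Icc] at *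
  refine ⟨neg_ne_zero.2 h.1, ?_, ?_⟩ <;> linarith [h.2.1, h.2.2]

lemma ofReal_re_fpartial (f : ℝ → ℝ) (J : ℕ) (x : ℝ) :
    (((fpartial f J x).re : ℝ) : ℂ) = fpartial f J x := by
  rw [← Complex.conj_eq_iff_re]
  unfold fpartial
  rw [map_sum]
  refine Finset.sum_nbij' (fun j => -j) (fun j => -j) (fun j hj => neg_mem_freqs hj)
    (fun j hj => neg_mem_freqs hj) (by simp) (by simp) fun j _ => ?_
  rw [map_mul, star_fcoef, star_trigChar]

lemma bddMeas_fpartial (f : ℝ → ℝ) (J : ℕ) : BddMeas (fpartial f J) :=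
  BddMeas.sum fun j _ => (bddMeas_const _).mul (bddMeas_trigChar j)

lemma trigChar_add_one (m : ℤ) (x : ℝ) : trigChar m (x + 1) = trigChar m x := by
  unfold trigChar
  rw [← Complex.exp_periodic.int_mul m (2 * Real.pi * Complex.I * m * x)]
  congr 1
  push_cast
  ring

lemma fpartial_add_one (f : ℝ → ℝ) (J : ℕ) (x : ℝ) : fpartial f J (x + 1) = fpartial f J x := by
  unfold fpartial
  simp_rw [trigChar_add_one]

variable {f : ℝ → ℝ}

lemma exists_abs_le_of_periodic (hper : ∀ x, f (x + 1) = f x)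
    (hvar : BoundedVariationOn f (Set.Icc 0 1)) : ∃ M : ℝ, ∀ x, |f x| ≤ M := by
  refine ⟨|f 0| + (eVariationOn f (Set.Icc 0 1)).toReal, fun x => ?_⟩
  have h1 : f x = f (Int.fract x) := by
    have := Function.Periodic.sub_zsmul_eq (f := f) (c := 1) hper (x := x) ⌊x⌋
    rw [← this]
    simp
  have h2 := hvar.dist_le (x := Int.fract x) (y := 0)
    ⟨Int.fract_nonneg x, (Int.fract_lt_one x).le⟩ (by simp)
  rw [Real.dist_eq] at h2
  rw [h1]
  have := abs_sub_abs_le_abs_sub (f (Int.fract x)) (f 0)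
  linarith

lemma trigChar_div_natAbs {j : ℤ} (hj : j ≠ 0) (a : ℕ) :
    trigChar (-j) ((a : ℝ) / (j.natAbs : ℝ)) = 1 := by
  have h1 : (j.natAbs : ℂ) ≠ 0 := by exact_mod_cast (Int.natAbs_pos.2 hj).ne'
  have h2 : (j : ℂ) = (j.sign : ℂ) * (j.natAbs : ℂ) := by
    rw [← Int.cast_natCast j.natAbs, ← Int.cast_mul, Int.sign_mul_natAbs]
  unfold trigChar
  rw [← Complex.exp_int_mul_two_pi_mul_I (-(j.sign * a))]
  congr 1
  push_cast
  rw [h2]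
  field_simp

lemma integral_trigChar_subinterval {j : ℤ} (hj : j ≠ 0) (a b : ℕ) :
    ∫ x in ((a : ℝ) / (j.natAbs : ℝ))..((b : ℝ) / (j.natAbs : ℝ)), trigChar (-j) x = 0 := by
  have ha := trigChar_div_natAbs hj a
  have hb := trigChar_div_natAbs hj b
  unfold trigChar at *
  have hc : 2 * (Real.pi : ℂ) * Complex.I * ((-j : ℤ) : ℂ) ≠ 0 := by
    simp [Real.pi_ne_zero, hj]
  rw [integral_exp_mul_complex hc, ha, hb]
  simp

/-- The Fourier coefficients of a function of bounded variation are `O(1 / j)`. -/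
lemma exists_norm_fcoef_le (hf : BddMeas f) (hvar : BoundedVariationOn f (Set.Icc 0 1)) :
    ∃ K : ℝ, 0 ≤ K ∧ ∀ j ≠ 0, ‖fcoef f j‖ ≤ K * |(j : ℝ)|⁻¹ := by
  -- With the Jordan decomposition `f = p - q`, the oscillation of `f` on an interval is at most the
  -- increment of `p + q`, and these increments telescope.
  obtain ⟨p, q, hp, hq, hpq⟩ := hvar.locallyBoundedVariationOn.exists_monotoneOn_sub_monotoneOn
  have h01 : (0 : ℝ) ∈ Set.Icc (0 : ℝ) 1 := by simp
  have h11 : (1 : ℝ) ∈ Set.Icc (0 : ℝ) 1 := by simp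
  have hp01 := hp h01 h11 zero_le_one
  have hq01 := hq h01 h11 zero_le_one
  refine ⟨(p 1 + q 1) - (p 0 + q 0), by linarith, fun j hj => ?_⟩
  have hjabs : |(j : ℝ)| = (j.natAbs : ℝ) := by rw [Nat.cast_natAbs, Int.cast_abs]
  rw [hjabs]
  set m := j.natAbs with hm
  have hm0 : (0 : ℝ) < m := by exact_mod_cast Int.natAbs_pos.2 hj
  have hint : BddMeas fun x => (f x : ℂ) * trigChar (-j) x := hf.ofReal.mul (bddMeas_trigChar _)
  have h1 : fcoef f j = ∑ i ∈ Finset.range m, ∫ x in ((i : ℕ) : ℝ) / m..((i + 1 : ℕ) : ℝ) / m,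
      (f x : ℂ) * trigChar (-j) x := by
    rw [intervalIntegral.sum_integral_adjacent_intervals (a := fun i : ℕ => (i : ℝ) / m)
      (fun k _ => hint.intervalIntegrable _ _), fcoef, integral_lebesgueUnit]
    simp [hm0.ne']
  have h2 : ∀ i ∈ Finset.range m, ‖∫ x in ((i : ℕ) : ℝ) / m..((i + 1 : ℕ) : ℝ) / m,
      (f x : ℂ) * trigChar (-j) x‖ ≤ ((p (((i + 1 : ℕ) : ℝ) / m) + q (((i + 1 : ℕ) : ℝ) / m)) -
        (p ((i : ℝ) / m) + q ((i : ℝ) / m))) * (m : ℝ)⁻¹ := by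
    intro i hi
    have him : i + 1 ≤ m := Finset.mem_range.1 hi
    have hle : (i : ℝ) / m ≤ ((i + 1 : ℕ) : ℝ) / m := by
      gcongr
      exact Nat.le_succ i
    have hb : ((i + 1 : ℕ) : ℝ) / m ≤ 1 := by
      rw [div_le_one hm0]
      exact_mod_cast him
    have ha : (0 : ℝ) ≤ (i : ℝ) / m := by positivity
    -- The interval is a full period of the character, so a constant may be subtracted from `f`.
    have e1 : ∫ x in ((i : ℕ) : ℝ) / m..((i + 1 : ℕ) : ℝ) / m, (f x : ℂ) * trigChar (-j) x =
        ∫ x in ((i : ℕ) : ℝ) / m..((i + 1 : ℕ) : ℝ) / m,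
          ((f x : ℂ) - (f ((i : ℝ) / m) : ℂ)) * trigChar (-j) x := by
      simp_rw [sub_mul]
      rw [intervalIntegral.integral_sub (hint.intervalIntegrable _ _)
        (((bddMeas_const _).mul (bddMeas_trigChar _)).intervalIntegrable _ _),
        intervalIntegral.integral_const_mul, hm, integral_trigChar_subinterval hj, mul_zero,
        sub_zero]
    rw [e1]
    refine (intervalIntegral.norm_integral_le_of_norm_le_const
      (C := (p (((i + 1 : ℕ) : ℝ) / m) + q (((i + 1 : ℕ) : ℝ) / m)) -
        (p ((i : ℝ) / m) + q ((i : ℝ) / m))) ?_).trans (le_of_eq ?_)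
    · intro x hx
      rw [Set.uIoc_of_le hle] at hx
      have hai : (i : ℝ) / m ∈ Set.Icc (0 : ℝ) 1 := ⟨ha, hle.trans hb⟩
      have hbi : ((i + 1 : ℕ) : ℝ) / m ∈ Set.Icc (0 : ℝ) 1 := ⟨ha.trans hle, hb⟩
      have hxi : x ∈ Set.Icc (0 : ℝ) 1 := ⟨ha.trans hx.1.le, hx.2.trans hb⟩
      rw [norm_mul, norm_trigChar, mul_one, ← Complex.ofReal_sub, Complex.norm_real,
        Real.norm_eq_abs, hpq, abs_le]
      have p1 := hp hai hxi hx.1.le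
      have p2 := hp hxi hbi hx.2
      have q1 := hq hai hxi hx.1.le
      have q2 := hq hxi hbi hx.2
      simp only [Pi.sub_apply]
      constructor <;> linarith
    · have : ((i + 1 : ℕ) : ℝ) / m - (i : ℝ) / m = (m : ℝ)⁻¹ := by
        push_cast
        ring
      rw [this, abs_of_pos (inv_pos.2 hm0)]
  rw [h1]
  refine (norm_sum_le_of_le _ h2).trans (le_of_eq ?_)
  rw [← Finset.sum_mul, Finset.sum_range_sub
    (fun i : ℕ => p ((i : ℝ) / m) + q ((i : ℝ) / m))]
  simp [hm0.ne']

lemma hasSum_sq_fcoef {g : ℝ → ℂ} (hg : BddMeas g) :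
    HasSum (fun j : ℤ => ‖∫ x, g x * trigChar (-j) x ∂lebesgueUnit‖ ^ 2)
      (∫ x, ‖g x‖ ^ 2 ∂lebesgueUnit) := by
  obtain ⟨hm, M, hM⟩ := id hg
  have h := hasSum_sq_fourierCoeffOn (f := g) (a := 0) (b := 1) zero_lt_one
    (MemLp.of_bound hm.aestronglyMeasurable M (Eventually.of_forall hM))
  rw [integral_lebesgueUnit]
  convert h using 1
  · funext j
    rw [fourierCoeffOn_eq_integral, integral_lebesgueUnit]
    simp only [sub_zero, div_one, one_smul, fourier_coe_apply, smul_eq_mul]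
    congr 3
    funext x
    rw [mul_comm, trigChar]
    simp
  · simp

/-- Parseval for the remainder, whose coefficients are those of `f` outside `freqs L`. The zeroth
one, missing from `fpartial`, vanishes because `f` has mean zero. -/
lemma exists_integral_sub_fpartial_le (hf : BddMeas f) (hmean : ∫ x, f x ∂lebesgueUnit = 0)
    {η : ℝ} (hη : 0 < η) (J : ℕ) :
    ∃ L, J ≤ L ∧ ∫ x, ‖(f x : ℂ) - fpartial f L x‖ ^ 2 ∂lebesgueUnit ≤ η := by
  classical
  have hsum := (hasSum_sq_fcoef hf.ofReal).summable
  obtain ⟨s, hs⟩ := summable_iff_vanishing_norm.1 hsum η hη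
  refine ⟨max J (s.sup Int.natAbs), le_max_left _ _, ?_⟩
  set L := max J (s.sup Int.natAbs)
  have hbd : BddMeas fun x => (f x : ℂ) - fpartial f L x := hf.ofReal.sub (bddMeas_fpartial f L)
  have h0 : fcoef f 0 = 0 := by
    unfold fcoef
    simp_rw [neg_zero, trigChar_zero, mul_one]
    rw [integral_complex_ofReal, hmean, Complex.ofReal_zero]
  have hcoef : ∀ j : ℤ, ∫ x, ((f x : ℂ) - fpartial f L x) * trigChar (-j) x ∂lebesgueUnit =
      if j ∈ freqs L then 0 else fcoef f j := by
    intro j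
    have e1 : ∀ x, ((f x : ℂ) - fpartial f L x) * trigChar (-j) x =
        (f x : ℂ) * trigChar (-j) x - ∑ i ∈ freqs L, fcoef f i * trigChar (i + -j) x := by
      intro x
      rw [sub_mul, fpartial, Finset.sum_mul]
      simp_rw [trigChar_add, mul_assoc]
    simp_rw [e1]
    rw [integral_sub (hf.ofReal.mul (bddMeas_trigChar _)).integrable
      (BddMeas.sum fun i _ => (bddMeas_const _).mul (bddMeas_trigChar _)).integrable,
      integral_finsetSum _ fun i _ => ((bddMeas_const _).mul (bddMeas_trigChar _)).integrable]
    simp_rw [integral_const_mul, integral_trigChar, ← sub_eq_add_neg, sub_eq_zero, mul_ite, mul_one,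
      mul_zero]
    rw [Finset.sum_ite_eq' (freqs L) j]
    split_ifs <;> simp [fcoef]
  have h := hasSum_sq_fcoef hbd
  simp_rw [hcoef] at h
  rw [← h.tsum_eq]
  refine Real.tsum_le_of_sum_le (fun j => by positivity) fun t => ?_
  have ht := hs ((t \ freqs L).erase 0) (by
    rw [Finset.disjoint_right]
    intro j hj hjt
    rw [Finset.mem_erase, Finset.mem_sdiff] at hjt
    refine hjt.2.2 ?_
    have h1 : j.natAbs ≤ L := (Finset.le_sup (f := Int.natAbs) hj).trans (le_max_right _ _)
    exact Finset.mem_erase.2 ⟨hjt.1, Finset.mem_Icc.2 ⟨by omega, by omega⟩⟩)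
  refine le_trans (le_of_eq ?_) ((le_abs_self _).trans ht.le)
  change ∑ j ∈ t, ‖if j ∈ freqs L then 0 else fcoef f j‖ ^ 2 =
    ∑ j ∈ (t \ freqs L).erase 0, ‖fcoef f j‖ ^ 2
  symm
  refine Finset.sum_subset_zero_on_sdiff
    ((Finset.erase_subset _ _).trans Finset.sdiff_subset) ?_ ?_
  · intro j hj
    rw [Finset.mem_sdiff, Finset.mem_erase, Finset.mem_sdiff] at hj
    by_cases hjL : j ∈ freqs L
    · simp [hjL]
    · have : j = 0 := by
        by_contra hne
        exact hj.2 ⟨hne, hj.1, hjL⟩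
      subst this
      simp [h0]
  · intro j hj
    rw [Finset.mem_erase, Finset.mem_sdiff] at hj
    simp [hj.2.2]

/-- Replacing a function of bounded variation by a partial sum of its Fourier series changes sums
along a sequence satisfying condition `A_2` only by little in mean square. -/
lemma exists_integral_sub_sum_fpartial_le {n : ℕ → ℕ} (hpos : ∀ k, 0 < n k)
    (hA : ConditionA n 2) (hf : BddMeas f) (hper : ∀ x, f (x + 1) = f x)
    (hmean : ∫ x, f x ∂lebesgueUnit = 0) (hvar : BoundedVariationOn f (Set.Icc 0 1))
    {ε : ℝ} (hε : 0 < ε) : ∃ J₀ : ℕ, ∀ J, J₀ ≤ J → ∀ F : Finset ℕ,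
      ∫ x, (∑ k ∈ F, f (n k * x) - ∑ k ∈ F, (fpartial f J (n k * x)).re) ^ 2 ∂lebesgueUnit ≤
        ε * F.card := by
  classical
  obtain ⟨K, _, hK⟩ := exists_norm_fcoef_le hf hvar
  obtain ⟨J₀, hJ₀⟩ := exists_integral_norm_sq_tail_le hpos hA hK (by positivity : 0 < ε / 4)
  refine ⟨J₀, fun J hJ F => ?_⟩
  rcases F.eq_empty_or_nonempty with rfl | hF
  · simp
  have hF0 : (0 : ℝ) < F.card := by exact_mod_cast hF.card_pos
  -- The level `L` may depend on `F`: it is so high that Cauchy–Schwarz over `F` suffices for the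
  -- remainder `R`. The block between `J` and `L` is bounded uniformly in `L` by the coincidence
  -- estimate.
  obtain ⟨L, hJL, hL⟩ := exists_integral_sub_fpartial_le hf hmean
    (by positivity : 0 < ε / (4 * F.card)) J
  set R : ℝ → ℂ := fun x => (f x : ℂ) - fpartial f L x with hR
  have hRb : BddMeas R := hf.ofReal.sub (bddMeas_fpartial f L)
  have hsub : freqs J ⊆ freqs L := by
    intro j hj
    unfold freqs at *
    rw [Finset.mem_erase, Finset.mem_Icc] at *
    have : (J : ℤ) ≤ L := by exact_mod_cast hJL
    exact ⟨hj.1, by linarith [hj.2.1], by linarith [hj.2.2]⟩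
  set T : ℝ → ℂ := fun x => ∑ k ∈ F, ∑ j ∈ freqs L \ freqs J, fcoef f j * trigChar j (n k * x)
    with hT
  have hTb : BddMeas T := BddMeas.sum fun k _ => BddMeas.sum fun j _ =>
    (bddMeas_const _).mul ((bddMeas_trigChar j).comp_mul _)
  have hpt : ∀ x, (∑ k ∈ F, f (n k * x) - ∑ k ∈ F, (fpartial f J (n k * x)).re) ^ 2 ≤
      2 * (F.card * ∑ k ∈ F, ‖R (n k * x)‖ ^ 2) + 2 * ‖T x‖ ^ 2 := by
    intro x
    have e1 : ((∑ k ∈ F, f (n k * x) - ∑ k ∈ F, (fpartial f J (n k * x)).re : ℝ) : ℂ) =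
        ∑ k ∈ F, R (n k * x) + T x := by
      push_cast
      simp_rw [ofReal_re_fpartial]
      rw [hT, ← Finset.sum_add_distrib, ← Finset.sum_sub_distrib]
      refine Finset.sum_congr rfl fun k _ => ?_
      have e2 : ∑ j ∈ freqs L \ freqs J, fcoef f j * trigChar j (n k * x) =
          fpartial f L (n k * x) - fpartial f J (n k * x) := by
        rw [fpartial, fpartial, ← Finset.sum_sdiff hsub, add_sub_cancel_right]
      rw [e2, hR]
      ring
    have e3 : (∑ k ∈ F, f (n k * x) - ∑ k ∈ F, (fpartial f J (n k * x)).re) ^ 2 =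
        ‖∑ k ∈ F, R (n k * x) + T x‖ ^ 2 := by
      rw [← e1, Complex.norm_real, Real.norm_eq_abs, sq_abs]
    have e4 : ‖∑ k ∈ F, R (n k * x)‖ ^ 2 ≤ F.card * ∑ k ∈ F, ‖R (n k * x)‖ ^ 2 :=
      (pow_le_pow_left₀ (norm_nonneg _) (norm_sum_le _ _) 2).trans sq_sum_le_card_mul_sum_sq
    have e5 : ‖∑ k ∈ F, R (n k * x) + T x‖ ^ 2 ≤ (‖∑ k ∈ F, R (n k * x)‖ + ‖T x‖) ^ 2 :=
      pow_le_pow_left₀ (norm_nonneg _) (norm_add_le _ _) 2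
    rw [e3]
    nlinarith [sq_nonneg (‖∑ k ∈ F, R (n k * x)‖ - ‖T x‖)]
  have hRk : ∀ k ∈ F, ∫ x, ‖R (n k * x)‖ ^ 2 ∂lebesgueUnit = ∫ x, ‖R x‖ ^ 2 ∂lebesgueUnit :=
    fun k _ => integral_comp_nat_mul (g := fun x => ‖R x‖ ^ 2) (hRb.norm.pow 2)
      (fun x => by rw [hR]; simp only [hper, fpartial_add_one]) (hpos k)
  have hRi : ∀ k ∈ F, BddMeas fun x => ‖R (n k * x)‖ ^ 2 := fun k _ => (hRb.comp_mul _).norm.pow 2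
  have hi1 : BddMeas fun x => 2 * (F.card * ∑ k ∈ F, ‖R (n k * x)‖ ^ 2) :=
    (bddMeas_const _).mul ((bddMeas_const _).mul (BddMeas.sum hRi))
  have hi2 : BddMeas fun x => 2 * ‖T x‖ ^ 2 := (bddMeas_const _).mul (hTb.norm.pow 2)
  have hi0 : BddMeas fun x =>
      (∑ k ∈ F, f (n k * x) - ∑ k ∈ F, (fpartial f J (n k * x)).re) ^ 2 := by
    refine BddMeas.pow (BddMeas.sub (BddMeas.sum fun k _ => hf.comp_mul _)
      (BddMeas.sum fun k _ => ?_)) 2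
    obtain ⟨hm, M, hM⟩ := (bddMeas_fpartial f J).comp_mul (n k)
    exact ⟨Complex.measurable_re.comp hm, M, fun x => (Complex.abs_re_le_norm _).trans (hM x)⟩
  refine (integral_mono hi0.integrable (hi1.add hi2).integrable hpt).trans ?_
  rw [integral_add hi1.integrable hi2.integrable, integral_const_mul, integral_const_mul,
    integral_const_mul, integral_finsetSum _ fun k hk => (hRi k hk).integrable,
    Finset.sum_congr rfl hRk, Finset.sum_const, nsmul_eq_mul]
  have h1 := hJ₀ J L hJ F
  have h2 : (F.card : ℝ) * (F.card * ∫ x, ‖R x‖ ^ 2 ∂lebesgueUnit) ≤ ε / 4 * F.card := by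
    calc _ ≤ (F.card : ℝ) * (F.card * (ε / (4 * F.card))) := by gcongr
      _ = _ := by field_simp
  linarith

end FourierCoefficients

/-! ### Stability of characteristic functions and variances under small mean-square changes -/

section Comparison

lemma norm_exp_mul_I_sub_le (u v : ℝ) :
    ‖Complex.exp (u * Complex.I) - Complex.exp (v * Complex.I)‖ ≤ |u - v| := by
  have h : Complex.exp (u * Complex.I) - Complex.exp (v * Complex.I) =
      Complex.exp (v * Complex.I) * (Complex.exp (Complex.I * ((u - v : ℝ) : ℂ)) - 1) := by
    rw [mul_sub, ← Complex.exp_add, mul_one]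
    congr 2
    push_cast
    ring
  rw [h, norm_mul, Complex.norm_exp_ofReal_mul_I, one_mul]
  exact Real.norm_exp_I_mul_ofReal_sub_one_le

lemma abs_exp_neg_sub_exp_neg_le {u v : ℝ} (hu : 0 ≤ u) (hv : 0 ≤ v) :
    |Real.exp (-u) - Real.exp (-v)| ≤ |u - v| := by
  wlog huv : u ≤ v generalizing u v
  · rw [abs_sub_comm, abs_sub_comm u]
    exact this hv hu (le_of_not_ge huv)
  have h1 : Real.exp (-v) ≤ Real.exp (-u) := Real.exp_le_exp.2 (by linarith)
  rw [abs_of_nonneg (by linarith), abs_sub_comm, abs_of_nonneg (by linarith)]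
  have h2 : Real.exp (-v) = Real.exp (-u) * Real.exp (-(v - u)) := by
    rw [← Real.exp_add]; congr 1; ring
  have h3 : Real.exp (-u) ≤ 1 := by rw [Real.exp_le_one_iff]; linarith
  have h4 := Real.add_one_le_exp (-(v - u))
  have h5 := Real.exp_pos (-u)
  rw [h2]
  nlinarith

variable {a b : ℝ → ℝ} {η : ℝ}

lemma norm_integral_exp_sub_le (ha : BddMeas a) (hb : BddMeas b) (hη : 0 < η)
    (hab : ∫ x, (a x - b x) ^ 2 ∂lebesgueUnit ≤ η ^ 2) (t : ℝ) :
    ‖∫ x, Complex.exp ((t * a x : ℝ) * Complex.I) ∂lebesgueUnit -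
      ∫ x, Complex.exp ((t * b x : ℝ) * Complex.I) ∂lebesgueUnit‖ ≤ |t| * η := by
  have hexp : ∀ {g : ℝ → ℝ}, BddMeas g →
      Integrable (fun x => Complex.exp ((t * g x : ℝ) * Complex.I)) lebesgueUnit := by
    intro g hg
    refine Integrable.of_bound ?_ 1 (Eventually.of_forall fun x => ?_)
    · have := hg.1
      exact (by fun_prop : Measurable fun x => Complex.exp ((t * g x : ℝ) * Complex.I)).aestronglyMeasurable
    · rw [Complex.norm_exp_ofReal_mul_I]
  rw [← integral_sub (hexp ha) (hexp hb)]
  have hsq : BddMeas fun x => (a x - b x) ^ 2 := (ha.sub hb).pow 2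
  -- The pointwise inequality `|d| ≤ η / 2 + d ^ 2 / (2 * η)` stands in for Cauchy–Schwarz.
  have hbd : BddMeas fun x => |t| * (η / 2) + |t| * (2 * η)⁻¹ * (a x - b x) ^ 2 :=
    (bddMeas_const _).add ((bddMeas_const _).mul hsq)
  refine (norm_integral_le_of_norm_le hbd.integrable (Eventually.of_forall fun x => ?_)).trans ?_
  · refine (norm_exp_mul_I_sub_le _ _).trans ?_
    rw [← mul_sub, abs_mul, mul_assoc, ← mul_add]
    gcongr
    have h1 : |a x - b x| * (2 * η) ≤ η ^ 2 + (a x - b x) ^ 2 := by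
      rw [← sq_abs (a x - b x)]
      nlinarith [sq_nonneg (|a x - b x| - η)]
    have h2 : |a x - b x| ≤ (η ^ 2 + (a x - b x) ^ 2) / (2 * η) := by
      rwa [le_div_iff₀ (by positivity)]
    refine h2.trans (le_of_eq ?_)
    field_simp
  · rw [integral_add (bddMeas_const (𝕜 := ℝ) _).integrable ((bddMeas_const _).mul hsq).integrable,
      integral_const, integral_const_mul, probReal_univ, one_smul]
    calc _ ≤ |t| * (η / 2) + |t| * (2 * η)⁻¹ * η ^ 2 := by gcongr
      _ = _ := by field_simp; ring

lemma abs_integral_sq_sub_le (ha : BddMeas a) (hb : BddMeas b) (hη : 0 < η)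
    (hab : ∫ x, (a x - b x) ^ 2 ∂lebesgueUnit ≤ η ^ 2) :
    |∫ x, a x ^ 2 ∂lebesgueUnit - ∫ x, b x ^ 2 ∂lebesgueUnit| ≤
      η ^ 2 + η + η * ∫ x, a x ^ 2 ∂lebesgueUnit := by
  rw [← integral_sub (ha.pow 2).integrable (hb.pow 2).integrable, ← Real.norm_eq_abs]
  have hsq : BddMeas fun x => (a x - b x) ^ 2 := (ha.sub hb).pow 2
  have h1 : BddMeas fun x => (1 + η⁻¹) * (a x - b x) ^ 2 := (bddMeas_const _).mul hsq
  have h2 : BddMeas fun x => η * a x ^ 2 := (bddMeas_const _).mul (ha.pow 2)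
  refine (norm_integral_le_of_norm_le (h1.add h2).integrable
    (Eventually.of_forall fun x => ?_)).trans ?_
  · rw [Real.norm_eq_abs]
    have e : a x ^ 2 - b x ^ 2 = 2 * a x * (a x - b x) - (a x - b x) ^ 2 := by ring
    -- Young's inequality, weighted so that after integration both terms are of order `η`.
    have h3 : |2 * a x * (a x - b x)| ≤ η * a x ^ 2 + η⁻¹ * (a x - b x) ^ 2 := by
      have h4 : |2 * a x * (a x - b x)| * η ≤ (η * a x ^ 2 + η⁻¹ * (a x - b x) ^ 2) * η := by
        have e2 : (η * a x ^ 2 + η⁻¹ * (a x - b x) ^ 2) * η = (η * a x) ^ 2 + (a x - b x) ^ 2 := by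
          field_simp
        rw [e2, ← abs_of_pos hη, ← abs_mul, abs_of_pos hη, abs_le]
        constructor <;> nlinarith [sq_nonneg (η * a x - (a x - b x)),
          sq_nonneg (η * a x + (a x - b x))]
      exact le_of_mul_le_mul_right h4 hη
    rw [e]
    refine (abs_sub _ _).trans ?_
    rw [abs_of_nonneg (sq_nonneg (a x - b x))]
    linarith
  · rw [integral_add h1.integrable h2.integrable, integral_const_mul, integral_const_mul]
    calc _ ≤ (1 + η⁻¹) * η ^ 2 + η * ∫ x, a x ^ 2 ∂lebesgueUnit := by gcongr
      _ = _ := by field_simp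

end Comparison

/-! ### Passage to the limit for permuted sums -/

section Limit

variable {n : ℕ → ℕ} {f : ℝ → ℝ}

/-- The set of the first `N` indices in the permuted order. -/
def permIndices (σ : Equiv.Perm ℕ) (N : ℕ) : Finset ℕ := (Finset.range N).map σ.toEmbedding

lemma card_permIndices (σ : Equiv.Perm ℕ) (N : ℕ) : (permIndices σ N).card = N := by
  simp [permIndices]

lemma permSum_eq_sum_permIndices (f : ℝ → ℝ) (n : ℕ → ℕ) (σ : Equiv.Perm ℕ) (N : ℕ) (x : ℝ) :
    permSum f n σ N x = ∑ k ∈ permIndices σ N, f (n k * x) := by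
  simp [permSum, permIndices]

lemma BddMeas.permSum (hf : BddMeas f) (n : ℕ → ℕ) (σ : Equiv.Perm ℕ) (N : ℕ) :
    BddMeas (permSum f n σ N) :=
  BddMeas.sum fun _ _ => hf.comp_mul _

lemma bddMeas_re_fpartial (f : ℝ → ℝ) (J : ℕ) : BddMeas fun x => (fpartial f J x).re := by
  obtain ⟨hm, M, hM⟩ := bddMeas_fpartial f J
  exact ⟨Complex.measurable_re.comp hm, M, fun x => (Complex.abs_re_le_norm _).trans (hM x)⟩

lemma isRealTrigSum_fpartial {C : ℕ → ℕ} {J : ℕ} {F : Finset ℕ}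
    (hC : NondegBound (letterVal n (freqs J) F) C) :
    IsRealTrigSum C (∑ j ∈ freqs J, ‖fcoef f j‖) (letterVal n (freqs J) F)
      (fun z => fcoef f z.1.1) (fun x => ∑ k ∈ F, (fpartial f J (n k * x)).re) := by
  refine ⟨hC, fun z => ?_, fun x => ?_⟩
  · exact Finset.single_le_sum (f := fun j => ‖fcoef f j‖) (fun _ _ => norm_nonneg _)
      (Finset.mem_product.1 z.2).1
  · unfold trigSum letterVal
    rw [Finset.sum_coe_sort (freqs J ×ˢ F) (fun p => fcoef f p.1 * trigChar (p.1 * n p.2) x),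
      Finset.sum_product_right]
    push_cast
    simp_rw [ofReal_re_fpartial, fpartial, trigChar_mul_nat]

/-- The characteristic functions of normalized permuted sums of a partial Fourier sum are
asymptotically those of centered normal distributions. -/
lemma eventually_charFun_fpartial (hpos : ∀ k, 0 < n k) (hmono : StrictMono n)
    (hA : ∀ p : ℕ, 2 ≤ p → ConditionA n p) (f : ℝ → ℝ) {J : ℕ} (hJ : 1 ≤ J) (t : ℝ) {ε : ℝ}
    (hε : 0 < ε) (σ : Equiv.Perm ℕ) :
    ∀ᶠ N : ℕ in atTop, ‖∫ x, Complex.exp ((t * ((√(N : ℝ))⁻¹ *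
        ∑ k ∈ permIndices σ N, (fpartial f J (n k * x)).re) : ℝ) * Complex.I) ∂lebesgueUnit -
      Complex.exp ((-(t ^ 2 * (∫ x, ((√(N : ℝ))⁻¹ *
        ∑ k ∈ permIndices σ N, (fpartial f J (n k * x)).re) ^ 2 ∂lebesgueUnit) / 2) : ℝ))‖ ≤ ε := by
  obtain ⟨C, hC⟩ := exists_nondegBound hpos hmono hA (D := freqs J)
    (fun j hj => ne_zero_of_mem_freqs hj)
  set d := (freqs J).card with hd
  have h1J : (1 : ℤ) ∈ freqs J :=
    Finset.mem_erase.2 ⟨one_ne_zero, Finset.mem_Icc.2 ⟨by omega, by omega⟩⟩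
  have hd0 : 0 < d := Finset.card_pos.2 ⟨1, h1J⟩
  have hd' : (0 : ℝ) < d := by exact_mod_cast hd0
  -- There are `d * N` letters, so the natural normalization is `√(d * N)`; rescaling `t` by `√d`
  -- restores `√N`.
  obtain ⟨X₀, hX₀⟩ := exists_charFun_approx C (∑ j ∈ freqs J, ‖fcoef f j‖) (t * √(d : ℝ)) hε
  filter_upwards [eventually_ge_atTop (max 1 X₀)] with N hN
  have hN1 : 1 ≤ N := (le_max_left _ _).trans hN
  have hN0 : (0 : ℝ) < N := by exact_mod_cast hN1
  have hcard : Fintype.card {x // x ∈ freqs J ×ˢ permIndices σ N} = d * N := by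
    rw [Fintype.card_coe, Finset.card_product, card_permIndices]
  have hne : Nonempty {x // x ∈ freqs J ×ˢ permIndices σ N} := by
    rw [← Fintype.card_pos_iff, hcard]
    positivity
  have h := hX₀ _ _ _ _ (isRealTrigSum_fpartial (f := f) (hC (permIndices σ N))) (by
    rw [hcard]
    exact (le_max_right _ _).trans (hN.trans (Nat.le_mul_of_pos_left N hd0)))
  rw [hcard] at h
  push_cast at h
  rw [Real.sqrt_mul hd'.le] at h
  have hsd : √(d : ℝ) ≠ 0 := (Real.sqrt_pos.2 hd').ne'
  have hsN : √(N : ℝ) ≠ 0 := (Real.sqrt_pos.2 hN0).ne'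
  have e1 : ∫ x, ((√(N : ℝ))⁻¹ * ∑ k ∈ permIndices σ N, (fpartial f J (n k * x)).re) ^ 2
      ∂lebesgueUnit = (N : ℝ)⁻¹ *
      ∫ x, (∑ k ∈ permIndices σ N, (fpartial f J (n k * x)).re) ^ 2 ∂lebesgueUnit := by
    simp_rw [mul_pow]
    rw [integral_const_mul, inv_pow, Real.sq_sqrt hN0.le]
  have e2 : (t * √(d : ℝ)) ^ 2 *
      ((∫ x, (∑ k ∈ permIndices σ N, (fpartial f J (n k * x)).re) ^ 2 ∂lebesgueUnit) / (d * N)) =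
      t ^ 2 * ((N : ℝ)⁻¹ *
      ∫ x, (∑ k ∈ permIndices σ N, (fpartial f J (n k * x)).re) ^ 2 ∂lebesgueUnit) := by
    rw [mul_pow, Real.sq_sqrt hd'.le]
    field_simp
  have e3 : ∀ s : ℝ, t * ((√(N : ℝ))⁻¹ * s) = t * √(d : ℝ) * (s / (√(d : ℝ) * √(N : ℝ))) := by
    intro s
    field_simp
  rw [e1, ← e2]
  simp_rw [e3]
  convert h using 3
  · push_cast
    rfl
  · push_cast
    rfl

lemma tendsto_integral_exp_permSum (hpos : ∀ k, 0 < n k) (hmono : StrictMono n)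
    (hA : ∀ p : ℕ, 2 ≤ p → ConditionA n p) (hf : BddMeas f) (hper : ∀ x, f (x + 1) = f x)
    (hmean : ∫ x, f x ∂lebesgueUnit = 0) (hvar : BoundedVariationOn f (Set.Icc 0 1))
    (σ : Equiv.Perm ℕ) {γ : ℝ} (hγ0 : 0 ≤ γ)
    (hγ : Tendsto (fun N : ℕ => ∫ x, ((√(N : ℝ))⁻¹ * permSum f n σ N x) ^ 2 ∂lebesgueUnit)
      atTop (𝓝 γ)) (t : ℝ) :
    Tendsto (fun N : ℕ => ∫ x, Complex.exp ((t * ((√(N : ℝ))⁻¹ * permSum f n σ N x) : ℝ) *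
      Complex.I) ∂lebesgueUnit) atTop (𝓝 (Complex.exp ((-(t ^ 2 * γ / 2) : ℝ)))) := by
  rw [Metric.tendsto_nhds]
  intro ε hε
  -- The terms of `Q` are the costs per unit of `η`: `|t|` for replacing the sum in the
  -- characteristic function, and `4 + γ` for the resulting change of variance including its
  -- distance to `γ`. The `1` keeps `Q` positive.
  set Q : ℝ := |t| + t ^ 2 / 2 * (4 + γ) + 1 with hQ
  have hQ0 : 0 < Q := by positivity
  obtain ⟨η, hη0, hη1, hηQ⟩ : ∃ η : ℝ, 0 < η ∧ η ≤ 1 ∧ η * Q ≤ ε / 4 := by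
    refine ⟨min 1 (ε / 4 / Q), by positivity, min_le_left _ _, ?_⟩
    rw [← le_div_iff₀ hQ0]
    exact min_le_right _ _
  obtain ⟨J₀, hJ₀⟩ := exists_integral_sub_sum_fpartial_le hpos (hA 2 le_rfl) hf hper hmean hvar
    (by positivity : 0 < η ^ 2)
  -- The level `max J₀ 1` is fixed before `N` grows; it is at least `1` so that the frequency set is
  -- nonempty.
  filter_upwards [eventually_charFun_fpartial hpos hmono hA f (le_max_right J₀ 1) t
    (by positivity : 0 < ε / 4) σ, Metric.tendsto_nhds.1 hγ η hη0, eventually_ge_atTop 1]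
    with N h1 h2 hN
  have hN0 : (0 : ℝ) < N := by exact_mod_cast hN
  set a : ℝ → ℝ := fun x => (√(N : ℝ))⁻¹ * permSum f n σ N x with ha
  set b : ℝ → ℝ := fun x => (√(N : ℝ))⁻¹ *
    ∑ k ∈ permIndices σ N, (fpartial f (max J₀ 1) (n k * x)).re with hb
  have hab : BddMeas a := (bddMeas_const _).mul (hf.permSum n σ N)
  have hbb : BddMeas b := (bddMeas_const _).mul
    (BddMeas.sum fun k _ => (bddMeas_re_fpartial f _).comp_mul _)
  have hd : ∫ x, (a x - b x) ^ 2 ∂lebesgueUnit ≤ η ^ 2 := by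
    have h3 := hJ₀ (max J₀ 1) (le_max_left _ _) (permIndices σ N)
    rw [card_permIndices] at h3
    have h4 : ∀ x, (a x - b x) ^ 2 = (N : ℝ)⁻¹ * (∑ k ∈ permIndices σ N, f (n k * x) -
        ∑ k ∈ permIndices σ N, (fpartial f (max J₀ 1) (n k * x)).re) ^ 2 := by
      intro x
      rw [ha, hb]
      simp only
      rw [permSum_eq_sum_permIndices, ← mul_sub, mul_pow, inv_pow, Real.sq_sqrt hN0.le]
    simp_rw [h4]
    rw [integral_const_mul, inv_mul_le_iff₀ hN0]
    linarith
  rw [Real.dist_eq] at h2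
  have hc1 := norm_integral_exp_sub_le hab hbb hη0 hd t
  have hc2 := abs_integral_sq_sub_le hab hbb hη0 hd
  have hVb : 0 ≤ ∫ x, b x ^ 2 ∂lebesgueUnit := integral_nonneg fun x => sq_nonneg _
  set Va := ∫ x, a x ^ 2 ∂lebesgueUnit
  set Vb := ∫ x, b x ^ 2 ∂lebesgueUnit
  have hVa : Va ≤ γ + 1 := by linarith [(abs_lt.1 h2).2]
  have hc3 : |Vb - γ| ≤ η * (4 + γ) := by
    have h5 : |Vb - γ| ≤ |Va - Vb| + |Va - γ| := by
      rw [abs_sub_comm Va Vb]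
      exact abs_sub_le _ _ _
    have h6 : η ^ 2 ≤ η := by nlinarith
    have h7 : η * Va ≤ η * (γ + 1) := by gcongr
    linarith
  have hc4 : ‖Complex.exp ((-(t ^ 2 * Vb / 2) : ℝ)) - Complex.exp ((-(t ^ 2 * γ / 2) : ℝ))‖ ≤
      t ^ 2 / 2 * (η * (4 + γ)) := by
    rw [← Complex.ofReal_exp, ← Complex.ofReal_exp, ← Complex.ofReal_sub, Complex.norm_real,
      Real.norm_eq_abs]
    refine (abs_exp_neg_sub_exp_neg_le (by positivity) (by positivity)).trans ?_
    rw [show t ^ 2 * Vb / 2 - t ^ 2 * γ / 2 = t ^ 2 / 2 * (Vb - γ) by ring, abs_mul,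
      abs_of_nonneg (by positivity : 0 ≤ t ^ 2 / 2)]
    gcongr
  rw [dist_eq_norm]
  have htri : ∀ z₁ z₂ z₃ z₄ : ℂ, ‖z₁ - z₄‖ ≤ ‖z₁ - z₂‖ + ‖z₂ - z₃‖ + ‖z₃ - z₄‖ := by
    intro z₁ z₂ z₃ z₄
    calc ‖z₁ - z₄‖ = ‖(z₁ - z₂) + (z₂ - z₃) + (z₃ - z₄)‖ := by congr 1; ring
      _ ≤ _ := norm_add₃_le
  refine lt_of_le_of_lt ((htri _ _ _ _).trans (add_le_add (add_le_add hc1 h1) hc4)) ?_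
  have : η * Q = |t| * η + t ^ 2 / 2 * (η * (4 + γ)) + η := by rw [hQ]; ring
  linarith

end Limit

end LacunaryPerm

/-! ### The central limit theorem -/

theorem theorem11
    (n : ℕ → ℕ) (hpos : ∀ k, 0 < n k) (hmono : StrictMono n)
    (hA : ∀ p : ℕ, 2 ≤ p → LacunaryPerm.ConditionA n p)
    (f : ℝ → ℝ) (hmeas : Measurable f) (hper : ∀ x, f (x + 1) = f x)
    (hmean : ∫ x in (0 : ℝ)..1, f x = 0)
    (hvar : BoundedVariationOn f (Set.Icc 0 1))
    (σ : Equiv.Perm ℕ) (γ : ℝ)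
    (hγ : Tendsto
      (fun N : ℕ => (N : ℝ)⁻¹ * ∫ x in (0 : ℝ)..1, (LacunaryPerm.permSum f n σ N x) ^ 2)
      atTop (𝓝 γ)) :
    TendstoInDistribution
      (fun (N : ℕ) (x : ℝ) => (√(N : ℝ))⁻¹ * LacunaryPerm.permSum f n σ N x) atTop
      (id : ℝ → ℝ) (fun _ => LacunaryPerm.lebesgueUnit) (gaussianReal 0 γ.toNNReal) := by
  have hf : LacunaryPerm.BddMeas f :=
    ⟨hmeas, LacunaryPerm.exists_abs_le_of_periodic hper hvar⟩
  have hX : ∀ N : ℕ, Measurable fun x => (√(N : ℝ))⁻¹ * LacunaryPerm.permSum f n σ N x :=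
    fun N => (hf.permSum n σ N).1.const_mul _
  have hmean' : ∫ x, f x ∂LacunaryPerm.lebesgueUnit = 0 := by
    rw [LacunaryPerm.integral_lebesgueUnit, hmean]
  have hγ' : Tendsto (fun N : ℕ => ∫ x, ((√(N : ℝ))⁻¹ * LacunaryPerm.permSum f n σ N x) ^ 2
      ∂LacunaryPerm.lebesgueUnit) atTop (𝓝 γ) := by
    refine hγ.congr fun N => ?_
    simp_rw [mul_pow]
    rw [integral_const_mul, inv_pow, Real.sq_sqrt (Nat.cast_nonneg _),
      LacunaryPerm.integral_lebesgueUnit]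
  have hγ0 : 0 ≤ γ := ge_of_tendsto' hγ' fun N => integral_nonneg fun x => sq_nonneg _
  refine ⟨fun N => (hX N).aemeasurable, aemeasurable_id, ?_⟩
  -- By Lévy's continuity theorem it suffices to treat characteristic functions; this also covers
  -- the degenerate case `γ = 0`.
  refine ProbabilityMeasure.tendsto_iff_tendsto_charFun.2 fun t => ?_
  have h := LacunaryPerm.tendsto_integral_exp_permSum hpos hmono hA hf hper hmean' hvar σ hγ0 hγ' t
  have e1 : charFun (Measure.map id (gaussianReal 0 γ.toNNReal)) t =
      Complex.exp ((-(t ^ 2 * γ / 2) : ℝ)) := by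
    rw [Measure.map_id, charFun_gaussianReal]
    congr 1
    rw [Real.coe_toNNReal _ hγ0]
    push_cast
    ring
  have e2 : ∀ N : ℕ, charFun (Measure.map (fun x => (√(N : ℝ))⁻¹ * LacunaryPerm.permSum f n σ N x)
      LacunaryPerm.lebesgueUnit) t = ∫ x, Complex.exp ((t * ((√(N : ℝ))⁻¹ *
        LacunaryPerm.permSum f n σ N x) : ℝ) * Complex.I) ∂LacunaryPerm.lebesgueUnit := by
    intro N
    rw [charFun_apply_real, integral_map (hX N).aemeasurable
      (by fun_prop)]
    push_cast
    rfl
  simp only [ProbabilityMeasure.coe_mk, e1, e2]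
  exact h
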